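/- **Setting.** Let $d\ge 1$, let $\Omega\subset\mathbb R^d$ satisfy $\Omega=\operatorname{int}\overline\Omega$, and let $\mathcal T$ be a conforming triangulation of $\Omega$: finitely many $d$-simplices whose closures cover $\overline\Omega$ and meet pairwise in a (possibly empty) common sub-simplex. Let $\mathcal E$ be the set of interfaces (facets common to two cells), and call the facets contained in $\partial\Omega$ boundary faces. With $n_T$ the outer unit normal of the cell $T$, set on an interface $e=\overline T_1\cap\overline T_2$ $$\{u\}=\tfrac12(u|_{T_1}+u|_{T_2}),\quad [\![\Phi]\!]=\Phi|_{T_1}n_{T_1}+\Phi|_{T_2}n_{T_2},\quad [\![u]\!]=u|_{T_1}\!\cdot n_{T_1}+u|_{T_2}\!\cdot n_{T_2},\quad [\![u]\!]_\otimes=u|_{T_1}\!\otimes n_{T_1}+u|_{T_2}\!\otimes n_{T_2}$$ for scalar $\Phi$ and vector-valued $u$ (averages are also taken of scalars and matrices), and use the one-sided expressions on boundary faces. For $k\in\mathbb N$ let $V_h$ be the space of functions that are polynomials of degree at most $k$ on every cell, $(V_{h,0})^d$ the fields in $(V_h)^d$ with zero trace on $\partial\Omega$, $V_{h,n}$ the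 fields in $(V_h)^d$ with zero normal trace on $\partial\Omega$, and $\mathcal V_h=V_h\times(V_{h,0})^d\times V_h\times V_h\times V_h\times V_{h,n}$. All derivatives in space are taken cell by cell. **Model.** Let $\gamma,\eta>0$; let $\tilde f(\rho,\varphi)$ be $C^1$ on $(0,\infty)\times[0,1]$; let $S(A,\varphi)=\nu(\varphi)(A+A^{\top})+\lambda(\varphi)\operatorname{tr}(A)I$ with $\nu,\lambda$ continuous on $[0,1]$ and $\nu>0$. For $\alpha_B>0$ put $$B_h[\varphi;v,X]=\int_\Omega S(\nabla v,\varphi):\nabla X\,dx-\int_{\mathcal E\cup\partial\Omega}\{S(\nabla v,\varphi)\}:[\![X]\!]_\otimes+\{S(\nabla X,\varphi)\}:[\![v]\!]_\otimes\,ds+\int_{\mathcal E\cup\partial\Omega}\frac{\alpha_B}{|e|}[\![v]\!]_\otimes:[\![X]\!]_\otimes\,ds .$$ The parameter $\alpha_B$ is assumed to be so big that $B_h[\varphi;\cdot,\cdot]$ is coercive on $(V_{h,0})^d$ for every $\varphi\in V_h$ with values in $[0,1]$, i.e. there is $c>0$ with $B_h[\varphi;v,v]\ge c\,\big(\int_\Omega|\nabla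 v|^2dx+\int_{\mathcal E\cup\partial\Omega}|e|^{-1}|[\![v]\!]_\otimes|^2ds\big)$ for all $v\in(V_{h,0})^d$. **Scheme.** A general semi-discrete dG approximation with fluxes $F_1,\dots,F_6$ is a curve $U_h=(\rho_h,v_h,\varphi_h,\mu_h,\tau_h,\sigma_h)\in C^0([0,T];\mathcal V_h)$, with $\rho_h,v_h,\varphi_h,\sigma_h$ differentiable in time, such that for every $t\in[0,T]$ one has $\varphi_h(t)\in[0,1]$ and $\rho_h(t)>0$ on every closed cell (traces included), and such that for all $t\in(0,T)$ and all $(\psi,X,\Theta,\chi,\zeta,Z)\in\mathcal V_h$ $$\begin{aligned} 0&=\int_\Omega(\partial_t\rho_h+\operatorname{div}(\rho_hv_h))\psi\,dx+\int_{\mathcal E}F_1[U_h,\psi]\,ds,\\ 0&=\int_\Omega\big(\rho_h\partial_tv_h+\operatorname{div}(\rho_hv_h\otimes v_h)-\operatorname{div}(\rho_hv_h)v_h+\rho_h\nabla\tau_h-\mu_h\nabla\varphi_h-\tfrac12\rho_h\nabla|v_h|^2\big)\cdot X\,dx+\int_{\mathcal E}F_2[U_h,X]\,ds+B_h[\varphi_h;v_h,X],\\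 0&=\int_\Omega\big(\partial_t\varphi_h+v_h\cdot\nabla\varphi_h+\eta\tfrac{\mu_h}{\rho_h}\big)\Theta\,dx+\int_{\mathcal E}F_3[U_h,\Theta]\,ds,\\ 0&=\int_\Omega\big(\mu_h-\tfrac{\partial(\rho\tilde f)}{\partial\varphi}(\rho_h,\varphi_h)+\gamma\operatorname{div}\sigma_h\big)\chi\,dx+\int_{\mathcal E}F_4[U_h,\chi]\,ds,\\ 0&=\int_\Omega\big(\tau_h-\tfrac{\partial(\rho\tilde f)}{\partial\rho}(\rho_h,\varphi_h)-\tfrac12|v_h|^2\big)\zeta\,dx+\int_{\mathcal E}F_5[U_h,\zeta]\,ds,\\ 0&=\int_\Omega(\sigma_h-\nabla\varphi_h)\cdot Z\,dx+\int_{\mathcal E}F_6[U_h,Z]\,ds . \end{aligned}$$ **Corollary (stabilized semi-discrete dG approximation).** Let $\alpha_1,\alpha_2,\alpha_3\ge0$ and let $$\begin{aligned} F_1&=-[\![\rho_hv_h]\!]\{\psi\}+\alpha_1[\![\tau_h]\!]\cdot[\![\psi]\!], & F_4&=-\gamma[\![\sigma_h]\!]\{\chi\},\\ F_2&=-[\![\tau_h]\!]\cdot\{\rho_hX\}+[\![\varphi_h]\!]\cdot\{\mu_hX\}+\alpha_2[\![v_h]\!][\![X]\!],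 & F_5&=0,\\ F_3&=-[\![\varphi_h]\!]\cdot\{\Theta v_h\}+\alpha_3[\![\mu_h]\!]\cdot[\![\Theta]\!], & F_6&=[\![\varphi_h]\!]\cdot\{Z\}. \end{aligned}$$ Then for every general semi-discrete dG approximation $U_h$ with these fluxes, the energy $$\hat E_h(t)=\int_\Omega\rho_h\tilde f(\rho_h,\varphi_h)+\tfrac\gamma2|\sigma_h|^2+\tfrac{\rho_h}2|v_h|^2\,dx$$ is differentiable on $(0,T)$, and for all $t\in(0,T)$ $$\frac{d}{dt}\hat E_h(t)=-\int_\Omega\frac{\eta}{\rho_h}\mu_h^2\,dx-B_h[\varphi_h;v_h,v_h]-\int_{\mathcal E}\alpha_1|[\![\tau_h]\!]|^2+\alpha_2[\![v_h]\!]^2+\alpha_3|[\![\mu_h]\!]|^2\,ds\;\le\;0 .$$ -/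

import Mathlib

namespace NSAC

noncomputable section

open Set MeasureTheory
open scoped Gradient

/-- Points and vectors of `ℝ^d` with the Euclidean structure. -/
abbrev Vec (d : ℕ) := EuclideanSpace ℝ (Fin d)

/-! ### Conforming triangulations -/

/-- A conforming triangulation of `Ω ⊆ ℝ^d` by finitely many `d`-simplices. A cell is recorded by
its finite set `T` of `d + 1` vertices; the closed simplex is `convexHull ℝ T`. -/
structure Triangulation (d : ℕ) (Ω : Set (Vec d)) where
  cells : Finset (Finset (Vec d))
  card_eq : ∀ T ∈ cells, T.card = d + 1
  affineIndependent : ∀ T ∈ cells, AffineIndependent ℝ ((↑) : {x // x ∈ T} → Vec d)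
  /-- two closed simplices meet in a (possibly empty) common sub-simplex -/
  conforming : ∀ T₁ ∈ cells, ∀ T₂ ∈ cells, ∃ S : Finset (Vec d), S ⊆ T₁ ∧ S ⊆ T₂ ∧
    convexHull ℝ (T₁ : Set (Vec d)) ∩ convexHull ℝ (T₂ : Set (Vec d)) =
      convexHull ℝ (S : Set (Vec d))
  cover : ⋃ T ∈ cells, convexHull ℝ (T : Set (Vec d)) = closure Ω

variable {d : ℕ} {Ω : Set (Vec d)}

namespace Triangulation

variable (M : Triangulation d Ω)

/-- The type of cells of the triangulation. -/
abbrev Cell := {T : Finset (Vec d) // T ∈ M.cells}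

open Classical in
/-- The facets (`(d-1)`-dimensional closed faces, recorded by their `d` vertices) of all cells. -/
def facets : Finset (Finset (Vec d)) :=
  M.cells.biUnion fun T => T.powersetCard d

open Classical in
/-- The set `𝓔` of interfaces: facets common to two distinct cells. -/
def interfaces : Finset (Finset (Vec d)) :=
  M.facets.filter fun F => ∃ T₁ ∈ M.cells, ∃ T₂ ∈ M.cells, T₁ ≠ T₂ ∧ F ⊆ T₁ ∧ F ⊆ T₂

open Classical in
/-- The boundary faces: facets that lie in `∂Ω`. -/
def boundaryFaces : Finset (Finset (Vec d)) :=
  M.facets.filter fun F => convexHull ℝ (F : Set (Vec d)) ⊆ frontier Ω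

open Classical in
/-- The cells that have the facet `F`: two for an interface, one for a boundary face. -/
def cellsAt (F : Finset (Vec d)) : Finset M.Cell :=
  Finset.univ.filter fun T => F ⊆ T.1

end Triangulation

/-- The outer unit normal `n_T` of the simplex with vertex set `T` on its facet `F`: the
normalized component, orthogonal to the facet, of the vector from the barycentre of `T` to
the barycentre of `F`. -/
def outerNormal (T F : Finset (Vec d)) : Vec d :=
  let w : Vec d := (vectorSpan ℝ (F : Set (Vec d)))ᗮ.starProjection
    (F.centroid ℝ id - T.centroid ℝ id)
  ‖w‖⁻¹ • w

/-- Surface integral `∫_F g ds` over a facet, with respect to the `(d-1)`-dimensional Hausdorff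
measure (normalized to agree with Lebesgue measure on `(d-1)`-planes). -/
def faceIntegral (F : Finset (Vec d)) (g : Vec d → ℝ) : ℝ :=
  ∫ x in convexHull ℝ (F : Set (Vec d)), g x ∂(Measure.euclideanHausdorffMeasure (d - 1))

/-- The `(d-1)`-dimensional measure `|F|` of a facet. -/
def faceArea (F : Finset (Vec d)) : ℝ :=
  (Measure.euclideanHausdorffMeasure (d - 1) : Measure (Vec d)).real
    (convexHull ℝ (F : Set (Vec d)))

/-! ### Broken functions, jumps, averages and integrals -/

/-- A broken function: on every cell `T` a function. The functions used are polynomials on each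
cell, given with their polynomial extension, so that the trace on a facet of `T` of the
restriction to `T` is just the restriction of `u T` to the facet. -/
abbrev Broken (M : Triangulation d Ω) (V : Type) := M.Cell → Vec d → V

variable {M : Triangulation d Ω}

/-- `∫_Ω g dx`, the sum of the integrals over the cells. -/
def domainIntegral (g : Broken M ℝ) : ℝ :=
  ∑ T : M.Cell, ∫ x in convexHull ℝ (T.1 : Set (Vec d)), g T x

variable (M) in
/-- `∫_𝓔 G ds`, the sum of the integrals over the interfaces. -/
def interfaceIntegral (G : Finset (Vec d) → Vec d → ℝ) : ℝ :=
  ∑ F ∈ M.interfaces, faceIntegral F (G F)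

variable (M) in
/-- `∫_{𝓔 ∪ ∂Ω} G ds`. -/
def skeletonIntegral (G : Finset (Vec d) → Vec d → ℝ) : ℝ :=
  ∑ F ∈ M.interfaces, faceIntegral F (G F) + ∑ F ∈ M.boundaryFaces, faceIntegral F (G F)

/-- The average `{u}` on a facet: `(u|_{T₁} + u|_{T₂}) / 2` on an interface and `u|_T` on a
boundary face. -/
def avg {V : Type} [AddCommGroup V] [Module ℝ V] (u : Broken M V) (F : Finset (Vec d))
    (x : Vec d) : V :=
  ((M.cellsAt F).card : ℝ)⁻¹ • ∑ T ∈ M.cellsAt F, u T x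

/-- The vector-valued jump `⟦u⟧` of a scalar function: `u|_{T₁} n_{T₁} + u|_{T₂} n_{T₂}` on an
interface and `u|_T n_T` on a boundary face. -/
def jump (u : Broken M ℝ) (F : Finset (Vec d)) (x : Vec d) : Vec d :=
  ∑ T ∈ M.cellsAt F, u T x • outerNormal T.1 F

/-- The scalar jump `⟦w⟧` of a vector function:
`w|_{T₁} · n_{T₁} + w|_{T₂} · n_{T₂}` on an interface and `w|_T · n_T` on a boundary face. -/
def jumpV (w : Broken M (Vec d)) (F : Finset (Vec d)) (x : Vec d) : ℝ :=
  ∑ T ∈ M.cellsAt F, inner ℝ (w T x) (outerNormal T.1 F)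

/-- The tensor jump `⟦w⟧_⊗` of a vector function:
`w|_{T₁} ⊗ n_{T₁} + w|_{T₂} ⊗ n_{T₂}` on an interface and `w|_T ⊗ n_T` on a boundary face. -/
def jumpT (w : Broken M (Vec d)) (F : Finset (Vec d)) (x : Vec d) : Matrix (Fin d) (Fin d) ℝ :=
  ∑ T ∈ M.cellsAt F, Matrix.vecMulVec (w T x) (outerNormal T.1 F)

/-! ### Differential operators -/

/-- The Jacobian matrix `(∇w)_{ij} = ∂_j w_i`. -/
def jacobian (w : Vec d → Vec d) (x : Vec d) : Matrix (Fin d) (Fin d) ℝ :=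
  Matrix.of fun i j => fderiv ℝ w x (EuclideanSpace.single j 1) i

/-- The divergence `div w = ∑ i, ∂_i w_i`. -/
def divergence (w : Vec d → Vec d) (x : Vec d) : ℝ := (jacobian w x).trace

/-- The row-wise divergence of `ρ v ⊗ v`: its `i`-th component is `∑ j, ∂_j (ρ v_i v_j)`. -/
def divConvection (ρ : Vec d → ℝ) (v : Vec d → Vec d) (x : Vec d) : Vec d :=
  WithLp.toLp 2 fun i => divergence (fun y => (ρ y * v y i) • v y) x

/-- The Frobenius product `A : B`. -/
def frob (A B : Matrix (Fin d) (Fin d) ℝ) : ℝ := ∑ i, ∑ j, A i j * B i j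

/-! ### Discrete spaces -/

/-- `g` is a polynomial function on `ℝ^d` of total degree at most `k`. -/
def IsPolyLE (k : ℕ) (g : Vec d → ℝ) : Prop :=
  ∃ p : MvPolynomial (Fin d) ℝ, p.totalDegree ≤ k ∧ ∀ x : Vec d, g x = MvPolynomial.eval (⇑x) p

variable (M) in
/-- `V_h`: piecewise polynomials of degree at most `k`. -/
def Vh (k : ℕ) : Set (Broken M ℝ) := {u | ∀ T, IsPolyLE k (u T)}

variable (M) in
/-- `(V_h)^d`. -/
def VhVec (k : ℕ) : Set (Broken M (Vec d)) := {w | ∀ i : Fin d, (fun T x => w T x i) ∈ Vh M k}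

variable (M) in
/-- `(V_{h,0})^d`: elements of `(V_h)^d` with zero trace on `∂Ω`. -/
def VhZero (k : ℕ) : Set (Broken M (Vec d)) :=
  {w | w ∈ VhVec M k ∧ ∀ F ∈ M.boundaryFaces, ∀ T ∈ M.cellsAt F,
    ∀ x ∈ convexHull ℝ (F : Set (Vec d)), w T x = 0}

variable (M) in
/-- `V_{h,n}`: elements of `(V_h)^d` with zero normal trace on `∂Ω`. -/
def VhNormal (k : ℕ) : Set (Broken M (Vec d)) :=
  {w | w ∈ VhVec M k ∧ ∀ F ∈ M.boundaryFaces, ∀ T ∈ M.cellsAt F,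
    ∀ x ∈ convexHull ℝ (F : Set (Vec d)), inner ℝ (w T x) (outerNormal T.1 F) = 0}

variable (M) in
/-- A six-tuple `(ρ, v, φ, μ, τ, σ)` of broken functions. -/
structure State where
  ρ : Broken M ℝ
  v : Broken M (Vec d)
  φ : Broken M ℝ
  μ : Broken M ℝ
  τ : Broken M ℝ
  σ : Broken M (Vec d)

variable (M) in
/-- The space `𝓥_h = V_h × (V_{h,0})^d × V_h × V_h × V_h × V_{h,n}`. -/
def StateSpace (k : ℕ) : Set (State M) :=
  {U | U.ρ ∈ Vh M k ∧ U.v ∈ VhZero M k ∧ U.φ ∈ Vh M k ∧ U.μ ∈ Vh M k ∧ U.τ ∈ Vh M k ∧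
    U.σ ∈ VhNormal M k}

/-! ### The model -/

/-- Data of the Navier-Stokes-Allen-Cahn model: the specific free energy `f(ρ, φ)` without its
gradient part, for densities `ρ > 0` and phase fields `φ ∈ [0, 1]`, the capillarity coefficient
`γ`, the mobility `η`, and the viscosity coefficients of the Newtonian viscous stress. -/
structure Model where
  f : ℝ → ℝ → ℝ
  f_contDiffOn : ContDiffOn ℝ 1 (fun p : ℝ × ℝ => f p.1 p.2) (Ioi 0 ×ˢ Icc 0 1)
  γ : ℝ
  γ_pos : 0 < γ
  η : ℝ
  η_pos : 0 < η
  ν : ℝ → ℝ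
  ν_continuousOn : ContinuousOn ν (Icc 0 1)
  ν_pos : ∀ s ∈ Icc (0 : ℝ) 1, 0 < ν s
  lam : ℝ → ℝ
  lam_continuousOn : ContinuousOn lam (Icc 0 1)

namespace Model

variable (D : Model)

/-- `∂(ρ f)/∂ρ (ρ, φ)`. -/
def dρ (r s : ℝ) : ℝ := deriv (fun r' => r' * D.f r' s) r

/-- `∂(ρ f)/∂φ (ρ, φ)`; one-sided at the end points of the range `[0, 1]` of `φ`. -/
def dφ (r s : ℝ) : ℝ := derivWithin (fun s' => r * D.f r s') (Icc 0 1) s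

/-- The viscous stress `S(A, φ) = ν(φ) (A + Aᵀ) + λ(φ) tr(A) I`, to be used with `A = ∇v`. -/
def stress (A : Matrix (Fin d) (Fin d) ℝ) (s : ℝ) : Matrix (Fin d) (Fin d) ℝ :=
  D.ν s • (A + A.transpose) + (D.lam s * A.trace) • (1 : Matrix (Fin d) (Fin d) ℝ)

/-- The broken stress field `S(∇w, φ)`. -/
def stressField (φ : Broken M ℝ) (w : Broken M (Vec d)) : Broken M (Matrix (Fin d) (Fin d) ℝ) :=
  fun T x => D.stress (jacobian (w T) x) (φ T x)

/-- The symmetric interior penalty form `B_h[φ; w, X]` with penalty parameter `αB`. -/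
def Bh (αB : ℝ) (φ : Broken M ℝ) (w X : Broken M (Vec d)) : ℝ :=
  domainIntegral (M := M) (fun T x => frob (D.stressField φ w T x) (jacobian (X T) x))
  - skeletonIntegral M (fun F x =>
      frob (avg (D.stressField φ w) F x) (jumpT X F x)
      + frob (avg (D.stressField φ X) F x) (jumpT w F x))
  + skeletonIntegral M (fun F x => αB / faceArea F * frob (jumpT w F x) (jumpT X F x))

/-- The discrete energy `∫_Ω ρ f(ρ, φ) + γ/2 |σ|² + ρ/2 |v|² dx`. -/
def energy (U : State M) : ℝ :=
  domainIntegral (M := M) fun T x => U.ρ T x * D.f (U.ρ T x) (U.φ T x)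
    + D.γ / 2 * ‖U.σ T x‖ ^ 2 + U.ρ T x / 2 * ‖U.v T x‖ ^ 2

end Model

/-- The square of the broken `H^1` (dG) norm on `(V_{h,0})^d`. -/
def dgNormSq (w : Broken M (Vec d)) : ℝ :=
  domainIntegral (M := M) (fun T x => frob (jacobian (w T) x) (jacobian (w T) x))
  + skeletonIntegral M (fun F x => (faceArea F)⁻¹ * frob (jumpT w F x) (jumpT w F x))

variable (M) in
/-- The penalty parameter `αB` is big enough: `B_h[φ; ·, ·]` is coercive on `(V_{h,0})^d` for every
`φ ∈ V_h` with values in `[0, 1]`. -/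
def Model.IsCoercivePenalty (D : Model) (k : ℕ) (αB : ℝ) : Prop :=
  ∀ φ ∈ Vh M k, (∀ T : M.Cell, ∀ x ∈ convexHull ℝ (T.1 : Set (Vec d)), φ T x ∈ Icc (0 : ℝ) 1) →
    ∃ c > 0, ∀ w ∈ VhZero M k, c * dgNormSq w ≤ D.Bh αB φ w w

/-! ### Numerical fluxes and the semi-discrete scheme -/

variable (M) in
/-- Numerical fluxes: they assign to a state and a test function a function on the interfaces. -/
structure Fluxes where
  F₁ : State M → Broken M ℝ → Finset (Vec d) → Vec d → ℝ
  F₂ : State M → Broken M (Vec d) → Finset (Vec d) → Vec d → ℝ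
  F₃ : State M → Broken M ℝ → Finset (Vec d) → Vec d → ℝ
  F₄ : State M → Broken M ℝ → Finset (Vec d) → Vec d → ℝ
  F₅ : State M → Broken M ℝ → Finset (Vec d) → Vec d → ℝ
  F₆ : State M → Broken M (Vec d) → Finset (Vec d) → Vec d → ℝ

variable (M) in
/-- The stabilized fluxes with parameters `α₁, α₂, α₃`. -/
def stabilizedFluxes (D : Model) (α₁ α₂ α₃ : ℝ) : Fluxes M where
  F₁ U ψ F x :=
    - (jumpV (fun T y => U.ρ T y • U.v T y) F x * avg ψ F x)
    + α₁ * inner ℝ (jump U.τ F x) (jump ψ F x)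
  F₂ U X F x :=
    - inner ℝ (jump U.τ F x) (avg (fun T y => U.ρ T y • X T y) F x)
    + inner ℝ (jump U.φ F x) (avg (fun T y => U.μ T y • X T y) F x)
    + α₂ * (jumpV U.v F x * jumpV X F x)
  F₃ U Θ F x :=
    - inner ℝ (jump U.φ F x) (avg (fun T y => Θ T y • U.v T y) F x)
    + α₃ * inner ℝ (jump U.μ F x) (jump Θ F x)
  F₄ U χ F x := - (D.γ * (jumpV U.σ F x * avg χ F x))
  F₅ _ _ _ _ := 0
  F₆ U Z F x := inner ℝ (jump U.φ F x) (avg Z F x)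

/-- `U : [0, t₁] → 𝓥_h` is a general spatially semi-discrete dG approximation on `[0, t₁]`, of
polynomial degree `k`, with numerical fluxes `Fl` and penalty parameter `αB`. Continuity and
differentiability in time of a curve in the finite-dimensional space of piecewise polynomials are
expressed through its point values. The traces of `ρ` on the closed cells are positive, i.e. `1/ρ`
is bounded; no initial value is prescribed. -/
structure IsSemiDiscrete (D : Model) (k : ℕ) (αB : ℝ) (Fl : Fluxes M) (t₁ : ℝ)
    (U : ℝ → State M) : Prop where
  mem : ∀ t ∈ Icc 0 t₁, U t ∈ StateSpace M k
  cont_ρ : ∀ T x, ContinuousOn (fun t => (U t).ρ T x) (Icc 0 t₁)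
  cont_v : ∀ T x, ContinuousOn (fun t => (U t).v T x) (Icc 0 t₁)
  cont_φ : ∀ T x, ContinuousOn (fun t => (U t).φ T x) (Icc 0 t₁)
  cont_μ : ∀ T x, ContinuousOn (fun t => (U t).μ T x) (Icc 0 t₁)
  cont_τ : ∀ T x, ContinuousOn (fun t => (U t).τ T x) (Icc 0 t₁)
  cont_σ : ∀ T x, ContinuousOn (fun t => (U t).σ T x) (Icc 0 t₁)
  diff_ρ : ∀ T x, DifferentiableOn ℝ (fun t => (U t).ρ T x) (Icc 0 t₁)
  diff_v : ∀ T x, DifferentiableOn ℝ (fun t => (U t).v T x) (Icc 0 t₁)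
  diff_φ : ∀ T x, DifferentiableOn ℝ (fun t => (U t).φ T x) (Icc 0 t₁)
  diff_σ : ∀ T x, DifferentiableOn ℝ (fun t => (U t).σ T x) (Icc 0 t₁)
  ρ_pos : ∀ t ∈ Icc 0 t₁, ∀ T : M.Cell, ∀ x ∈ convexHull ℝ (T.1 : Set (Vec d)),
    0 < (U t).ρ T x
  φ_mem : ∀ t ∈ Icc 0 t₁, ∀ T : M.Cell, ∀ x ∈ convexHull ℝ (T.1 : Set (Vec d)),
    (U t).φ T x ∈ Icc (0 : ℝ) 1
  mass : ∀ t ∈ Ioo 0 t₁, ∀ ψ ∈ Vh M k,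
    0 = domainIntegral (M := M) (fun T x =>
          (deriv (fun s => (U s).ρ T x) t
            + divergence (fun y => (U t).ρ T y • (U t).v T y) x) * ψ T x)
        + interfaceIntegral M (Fl.F₁ (U t) ψ)
  momentum : ∀ t ∈ Ioo 0 t₁, ∀ X ∈ VhZero M k,
    0 = domainIntegral (M := M) (fun T x =>
          inner ℝ
            ((U t).ρ T x • deriv (fun s => (U s).v T x) t
              + divConvection ((U t).ρ T) ((U t).v T) x
              - divergence (fun y => (U t).ρ T y • (U t).v T y) x • (U t).v T x
              + (U t).ρ T x • ∇ ((U t).τ T) x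
              - (U t).μ T x • ∇ ((U t).φ T) x
              - ((1 / 2 : ℝ) * (U t).ρ T x) • ∇ (fun y => ‖(U t).v T y‖ ^ 2) x)
            (X T x))
        + interfaceIntegral M (Fl.F₂ (U t) X)
        + D.Bh αB (U t).φ (U t).v X
  phase : ∀ t ∈ Ioo 0 t₁, ∀ Θ ∈ Vh M k,
    0 = domainIntegral (M := M) (fun T x =>
          (deriv (fun s => (U s).φ T x) t
            + inner ℝ ((U t).v T x) (∇ ((U t).φ T) x)
            + D.η * ((U t).μ T x / (U t).ρ T x)) * Θ T x)
        + interfaceIntegral M (Fl.F₃ (U t) Θ)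
  potential_μ : ∀ t ∈ Ioo 0 t₁, ∀ χ ∈ Vh M k,
    0 = domainIntegral (M := M) (fun T x =>
          ((U t).μ T x - D.dφ ((U t).ρ T x) ((U t).φ T x)
            + D.γ * divergence ((U t).σ T) x) * χ T x)
        + interfaceIntegral M (Fl.F₄ (U t) χ)
  potential_τ : ∀ t ∈ Ioo 0 t₁, ∀ ζ ∈ Vh M k,
    0 = domainIntegral (M := M) (fun T x =>
          ((U t).τ T x - D.dρ ((U t).ρ T x) ((U t).φ T x)
            - 1 / 2 * ‖(U t).v T x‖ ^ 2) * ζ T x)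
        + interfaceIntegral M (Fl.F₅ (U t) ζ)
  gradient_σ : ∀ t ∈ Ioo 0 t₁, ∀ Z ∈ VhNormal M k,
    0 = domainIntegral (M := M) (fun T x => inner ℝ ((U t).σ T x - ∇ ((U t).φ T) x) (Z T x))
        + interfaceIntegral M (Fl.F₆ (U t) Z)

end

end NSAC

/-!
The energy identity results from testing the mass balance with `τ`, the momentum balance with `v`,
the phase field equation with `μ`, the equations for `μ` and `τ` with `∂ₜφ` and `∂ₜρ`, and the
equation for `σ`, differentiated in time, with `γ σ`: by the chain rule, the sum of the tested
densities is the time derivative of the energy density, up to the dissipation `η μ² / ρ` and two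
terms in divergence form. These are integrated by parts on every simplex. On a facet that is not
an interface the relevant normal traces vanish, and on the interfaces the resulting jump terms
cancel against the consistent parts of the fluxes, so that only the stabilization survives.
-/

namespace NSAC

noncomputable section

open Set MeasureTheory
open scoped Gradient

/-! ### Hausdorff and Lebesgue measure in affine parametrizations -/

section Measure

variable {m n : ℕ}

theorem euclideanHausdorffMeasure_inter_affine_image (L : Vec m →ₗ[ℝ] Vec n) (a : Vec n)
    (t : Set (Vec n)) (s : Set (Vec m)) :
    (Measure.euclideanHausdorffMeasure m : Measure (Vec n)) (t ∩ (fun y => a + L y) '' s) =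
      ENNReal.ofReal L.normDet * volume ((fun y => a + L y) ⁻¹' t ∩ s) := by
  have himage : t ∩ (fun y => a + L y) '' s =
      (fun x => a + x) '' (L '' ((fun y => a + L y) ⁻¹' t ∩ s)) := by
    rw [image_image, image_preimage_inter]
  have hL := L.euclideanHausdorffMeasure_image_eq_normDet_mul_volume
    ((fun y => a + L y) ⁻¹' t ∩ s)
  rw [finrank_euclideanSpace_fin] at hL
  rw [himage, (isometry_add_left a).euclideanHausdorffMeasure_image, hL]

theorem euclideanHausdorffMeasure_restrict_affine_image (L : Vec m →ₗ[ℝ] Vec n) (a : Vec n)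
    (s : Set (Vec m)) :
    (Measure.euclideanHausdorffMeasure m : Measure (Vec n)).restrict ((fun y => a + L y) '' s) =
      ENNReal.ofReal L.normDet • (volume.restrict s).map (fun y => a + L y) := by
  have hm : Measurable fun y => a + L y :=
    (continuous_const.add L.continuous_of_finiteDimensional).measurable
  ext t ht
  rw [Measure.restrict_apply ht, euclideanHausdorffMeasure_inter_affine_image, Measure.smul_apply,
    Measure.map_apply hm ht, Measure.restrict_apply (hm ht), smul_eq_mul]

theorem volume_eq_smul_map_orthogonal (L : Vec m →ₗ[ℝ] Vec (m + 1)) {ν : Vec (m + 1)}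
    (hν : ‖ν‖ = 1) (hL : L.range = (ℝ ∙ ν)ᗮ) :
    (volume : Measure (Vec (m + 1))) = ENNReal.ofReal L.normDet •
      ((volume : Measure ℝ).prod (volume : Measure (Vec m))).map
        (fun p => p.1 • ν + L p.2) := by
  have hLc : Continuous L := L.continuous_of_finiteDimensional
  have hm : Measurable fun p : ℝ × Vec m => p.1 • ν + L p.2 := by fun_prop
  have hslice : ∀ s : ℝ, (AffineSubspace.mk' (s • ν +ᵥ (0 : Vec (m + 1))) (ℝ ∙ ν)ᗮ :
      Set (Vec (m + 1))) = (fun y => s • ν + L y) '' univ := by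
    intro s
    ext z
    simp [AffineSubspace.mem_mk', ← hL, sub_eq_iff_eq_add', eq_comm]
  have hν_enorm : ‖ν‖ₑ = 1 := by rw [← ofReal_norm, hν, ENNReal.ofReal_one]
  ext t ht
  have hslices := EuclideanGeometry.euclideanHausdorffMeasure_eq_lintegral (0 : Vec (m + 1))
    (norm_ne_zero_iff.1 (hν ▸ one_ne_zero)) ht
  rw [InnerProductSpace.euclideanHausdorffMeasure_eq_volume, finrank_euclideanSpace_fin,
    Nat.add_sub_cancel] at hslices
  simp only [hslice, euclideanHausdorffMeasure_inter_affine_image, inter_univ, hν_enorm,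
    one_mul] at hslices
  rw [hslices, Measure.smul_apply, Measure.map_apply hm ht, Measure.prod_apply (hm ht),
    smul_eq_mul, ← lintegral_const_mul' _ _ ENNReal.ofReal_ne_top]
  rfl

theorem smul_map_shear_prod {h : ℝ} (hh : h ≠ 0) (w : Vec m) :
    ENNReal.ofReal |h| • ((volume : Measure ℝ).prod (volume : Measure (Vec m))).map
        (fun p => (h * p.1, p.2 + p.1 • w)) =
      (volume : Measure ℝ).prod (volume : Measure (Vec m)) := by
  have hshear : MeasurePreserving (fun p : ℝ × Vec m => (h * p.1, p.2 + p.1 • w))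
      ((volume : Measure ℝ).prod (volume : Measure (Vec m)))
      (((volume : Measure ℝ).map (h * ·)).prod (volume : Measure (Vec m))) :=
    MeasurePreserving.skew_product (g := fun s y => y + s • w) ⟨by fun_prop, rfl⟩ (by fun_prop)
      (Filter.Eventually.of_forall fun s =>
        (measurePreserving_add_right volume (s • w)).map_eq)
  rw [hshear.map_eq, ← Measure.prod_smul_left, Real.map_volume_mul_left hh, smul_smul,
    ← ENNReal.ofReal_mul (abs_nonneg _), ← abs_mul, mul_inv_cancel₀ hh, abs_one,
    ENNReal.ofReal_one, one_smul]

theorem volume_eq_smul_map_transversal (L : Vec m →ₗ[ℝ] Vec (m + 1)) {ν e : Vec (m + 1)}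
    (a : Vec (m + 1)) (hν : ‖ν‖ = 1) (hL : L.range = (ℝ ∙ ν)ᗮ) (he : inner ℝ ν e ≠ 0) :
    (volume : Measure (Vec (m + 1))) = ENNReal.ofReal (L.normDet * |inner ℝ ν e|) •
      ((volume : Measure ℝ).prod (volume : Measure (Vec m))).map
        (fun p => a + L p.2 + p.1 • e) := by
  have hLc : Continuous L := L.continuous_of_finiteDimensional
  obtain ⟨w, hw⟩ : ∃ w, L w = e - (inner ℝ ν e : ℝ) • ν := by
    rw [← LinearMap.mem_range, hL, Submodule.mem_orthogonal_singleton_iff_inner_right,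
      inner_sub_right, inner_smul_right, real_inner_self_eq_norm_sq, hν]
    simp
  rw [← (measurePreserving_add_left volume a).map_eq]
  conv_lhs => rw [volume_eq_smul_map_orthogonal L hν hL, ← smul_map_shear_prod he w]
  rw [Measure.map_smul, Measure.map_smul, Measure.map_smul, smul_smul,
    ← ENNReal.ofReal_mul L.normDet_nonneg, Measure.map_map (by fun_prop) (by fun_prop),
    Measure.map_map (by fun_prop) (by fun_prop)]
  congr 2
  ext1 p
  simp only [Function.comp, map_add, map_smul, hw]
  module

end Measure

/-! ### Simplices and their outer unit normals -/

section Normal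

variable {d : ℕ}

/-- The finite set `T` is the vertex set of a nondegenerate `d`-simplex in `ℝ^d`. -/
structure IsSimplex (T : Finset (Vec d)) : Prop where
  card_eq : T.card = d + 1
  affineIndependent : AffineIndependent ℝ ((↑) : {x // x ∈ T} → Vec d)

theorem IsSimplex.affineSpan_eq_top {T : Finset (Vec d)} (hT : IsSimplex T) :
    affineSpan ℝ (T : Set (Vec d)) = ⊤ := by
  have h := hT.affineIndependent.affineSpan_eq_top_iff_card_eq_finrank_add_one.2
    (by simp [hT.card_eq])
  rwa [Subtype.range_coe] at h

theorem IsSimplex.card_erase [DecidableEq (Vec d)] {T : Finset (Vec d)} (hT : IsSimplex T)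
    {q : Vec d} (hq : q ∈ T) : (T.erase q).card = d := by
  rw [Finset.card_erase_of_mem hq, hT.card_eq, Nat.add_sub_cancel]

theorem centroid_eq_smul_sum {F : Finset (Vec d)} (hF : F.Nonempty) :
    F.centroid ℝ id = (F.card : ℝ)⁻¹ • ∑ x ∈ F, x := by
  rw [Finset.centroid_def, Finset.affineCombination_eq_linear_combination _ _ _
    (Finset.sum_centroidWeights_eq_one_of_nonempty ℝ F hF)]
  simp [Finset.centroidWeights, Finset.smul_sum]

theorem centroid_mem_affineSpan {F : Finset (Vec d)} (hF : F.Nonempty) :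
    F.centroid ℝ id ∈ affineSpan ℝ (F : Set (Vec d)) :=
  convexHull_subset_affineSpan _ (F.centroid_mem_convexHull hF)

theorem outerNormal_mem_orthogonal (T F : Finset (Vec d)) :
    outerNormal T F ∈ (vectorSpan ℝ (F : Set (Vec d)))ᗮ :=
  Submodule.smul_mem _ _ (Submodule.starProjection_apply_mem _ _)

theorem inner_outerNormal_sub_eq_zero (T : Finset (Vec d)) {F : Finset (Vec d)} {x y : Vec d}
    (hx : x ∈ affineSpan ℝ (F : Set (Vec d))) (hy : y ∈ affineSpan ℝ (F : Set (Vec d))) :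
    inner ℝ (outerNormal T F) (x - y) = 0 := by
  refine Submodule.inner_left_of_mem_orthogonal ?_ (outerNormal_mem_orthogonal T F)
  rw [← direction_affineSpan]
  exact AffineSubspace.vsub_mem_direction hx hy

variable [DecidableEq (Vec d)] {T : Finset (Vec d)} {q : Vec d}

theorem card_smul_centroid_erase_sub_centroid (hq : q ∈ T) (hF : (T.erase q).Nonempty) :
    (T.card : ℝ) • ((T.erase q).centroid ℝ id - T.centroid ℝ id) =
      (T.erase q).centroid ℝ id - q := by
  have hcard : (T.card : ℝ) = (T.erase q).card + 1 := by
    exact_mod_cast (Finset.card_erase_add_one hq).symm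
  have hF0 : ((T.erase q).card : ℝ) ≠ 0 := by simpa using hF.ne_empty
  have hT0 : ((T.erase q).card : ℝ) + 1 ≠ 0 := by positivity
  rw [centroid_eq_smul_sum hF, centroid_eq_smul_sum ⟨q, hq⟩, ← Finset.sum_erase_add T _ hq, hcard]
  match_scalars <;> field_simp
  ring

theorem centroid_erase_sub_centroid_notMem_vectorSpan
    (hT : AffineIndependent ℝ ((↑) : {x // x ∈ T} → Vec d)) (hq : q ∈ T)
    (hF : (T.erase q).Nonempty) :
    (T.erase q).centroid ℝ id - T.centroid ℝ id ∉
      vectorSpan ℝ ((T.erase q : Finset (Vec d)) : Set (Vec d)) := by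
  intro h
  have hq_notMem : q ∉ affineSpan ℝ ((T.erase q : Finset (Vec d)) : Set (Vec d)) := by
    convert hT.notMem_affineSpan_sdiff ⟨q, hq⟩ univ using 3
    ext x
    simp [and_comm]
  have hdir := Submodule.smul_mem _ (T.card : ℝ) h
  rw [card_smul_centroid_erase_sub_centroid hq hF, ← direction_affineSpan, ← vsub_eq_sub,
    AffineSubspace.vsub_left_mem_direction_iff_mem (centroid_mem_affineSpan hF)] at hdir
  exact hq_notMem hdir

theorem starProjection_centroid_sub_centroid_ne_zero
    (hT : AffineIndependent ℝ ((↑) : {x // x ∈ T} → Vec d)) (hq : q ∈ T)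
    (hF : (T.erase q).Nonempty) :
    (vectorSpan ℝ ((T.erase q : Finset (Vec d)) : Set (Vec d)))ᗮ.starProjection
      ((T.erase q).centroid ℝ id - T.centroid ℝ id) ≠ 0 := by
  rw [Ne, Submodule.starProjection_apply_eq_zero_iff, Submodule.orthogonal_orthogonal]
  exact centroid_erase_sub_centroid_notMem_vectorSpan hT hq hF

theorem norm_outerNormal (hT : AffineIndependent ℝ ((↑) : {x // x ∈ T} → Vec d)) (hq : q ∈ T)
    (hF : (T.erase q).Nonempty) : ‖outerNormal T (T.erase q)‖ = 1 :=
  norm_smul_inv_norm (𝕜 := ℝ) (starProjection_centroid_sub_centroid_ne_zero hT hq hF)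

theorem inner_outerNormal_sub_neg (hT : AffineIndependent ℝ ((↑) : {x // x ∈ T} → Vec d))
    (hq : q ∈ T) {p : Vec d} (hp : p ∈ affineSpan ℝ ((T.erase q : Finset (Vec d)) : Set (Vec d))) :
    inner ℝ (outerNormal T (T.erase q)) (q - p) < 0 := by
  have hF : (T.erase q).Nonempty :=
    Finset.coe_nonempty.1 ((affineSpan_nonempty ℝ).1 ⟨p, hp⟩)
  have hsplit : q - p = ((T.erase q).centroid ℝ id - p) -
      (T.card : ℝ) • ((T.erase q).centroid ℝ id - T.centroid ℝ id) := by
    rw [card_smul_centroid_erase_sub_centroid hq hF]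
    abel
  have hcard : (0 : ℝ) < T.card := by exact_mod_cast Finset.card_pos.2 ⟨q, hq⟩
  have hw := norm_pos_iff.2 (starProjection_centroid_sub_centroid_ne_zero hT hq hF)
  rw [Submodule.starProjection_apply, Submodule.norm_coe] at hw
  have hinner := (pow_pos hw 2).trans_eq
    (Submodule.re_inner_starProjection_eq_normSq (𝕜 := ℝ) _ _).symm
  rw [RCLike.re_to_real] at hinner
  rw [hsplit, inner_sub_right, inner_outerNormal_sub_eq_zero T (centroid_mem_affineSpan hF) hp,
    zero_sub, neg_lt_zero, inner_smul_right, outerNormal, real_inner_smul_left]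
  positivity

theorem IsSimplex.vectorSpan_erase (hT : IsSimplex T) (hq : q ∈ T) (hF : (T.erase q).Nonempty) :
    vectorSpan ℝ ((T.erase q : Finset (Vec d)) : Set (Vec d)) =
      (ℝ ∙ outerNormal T (T.erase q))ᗮ := by
  have hν : outerNormal T (T.erase q) ≠ 0 :=
    norm_ne_zero_iff.1 (norm_outerNormal hT.affineIndependent hq hF ▸ one_ne_zero)
  obtain ⟨m, rfl⟩ : ∃ m, d = m + 1 :=
    Nat.exists_eq_succ_of_ne_zero (hT.card_erase hq ▸ hF.card_ne_zero)
  have : Fact (Module.finrank ℝ (Vec (m + 1)) = m + 1) := ⟨finrank_euclideanSpace_fin⟩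
  have hindep : AffineIndependent ℝ ((↑) : {x // x ∈ T.erase q} → Vec (m + 1)) :=
    hT.affineIndependent.mono (Finset.coe_subset.2 (T.erase_subset q))
  have hdim := hindep.finrank_vectorSpan (n := m) (by simp [hT.card_erase hq])
  refine Submodule.eq_of_le_of_finrank_eq (fun x hx => ?_) ?_
  · rw [Submodule.mem_orthogonal_singleton_iff_inner_right]
    exact Submodule.inner_left_of_mem_orthogonal hx (outerNormal_mem_orthogonal _ _)
  · rw [Submodule.finrank_orthogonal_span_singleton (n := m) hν]
    rwa [show range ((↑) : {x // x ∈ T.erase q} → Vec (m + 1)) = (T.erase q : Finset _) from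
      Subtype.range_coe] at hdim

end Normal

/-! ### The divergence theorem on a simplex -/

section Parametrization

variable {m n : ℕ}

/-- The corner simplex `{y | 0 ≤ y, ∑ y ≤ 1}`, the parameter domain of a facet. -/
def corner (m : ℕ) : Set (Vec m) := {y | (∀ j, 0 ≤ y j) ∧ ∑ j, y j ≤ 1}

/-- The corner simplex of `ℝ × ℝ^m`, the parameter domain of a cell. It is fibred over the corner
simplex of `ℝ^m`, the parameter domain of the facet opposite to the vertex `(1, 0)`. -/
def prodCorner (m : ℕ) : Set (ℝ × Vec m) :=
  {z | z.2 ∈ corner m ∧ z.1 ∈ Icc 0 (1 - ∑ j, z.2 j)}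

/-- The linear map sending the `j`-th basis vector to the edge vector `r j - p`. -/
def edgeMap (p : Vec n) (r : Fin m → Vec n) : Vec m →ₗ[ℝ] Vec n :=
  Fintype.linearCombination ℝ (fun j => r j - p) ∘ₗ
    (WithLp.linearEquiv 2 ℝ (Fin m → ℝ)).toLinearMap

theorem edgeMap_apply (p : Vec n) (r : Fin m → Vec n) (y : Vec m) :
    edgeMap p r y = ∑ j, y j • (r j - p) := by
  simp [edgeMap, Fintype.linearCombination_apply]

theorem add_edgeMap_eq (p : Vec n) (r : Fin m → Vec n) (y : Vec m) :
    p + edgeMap p r y = (1 - ∑ j, y j) • p + ∑ j, y j • r j := by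
  simp only [edgeMap_apply, smul_sub, Finset.sum_sub_distrib, ← Finset.sum_smul]
  module

theorem range_edgeMap (p : Vec n) (r : Fin m → Vec n) :
    (edgeMap p r).range = vectorSpan ℝ (insert p (range r)) := by
  rw [edgeMap, LinearMap.range_comp, LinearEquiv.range, Submodule.map_top,
    Fintype.range_linearCombination, vectorSpan_eq_span_vsub_set_right ℝ (mem_insert p _),
    image_insert_eq, ← range_comp]
  simp [Function.comp_def, Submodule.span_insert_zero]

theorem isClosed_corner : IsClosed (corner m) :=
  (isClosed_Ici.preimage (PiLp.continuous_ofLp 2 _)).inter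
    (isClosed_le (by fun_prop : Continuous fun y : Vec m => ∑ j, y j) continuous_const)

theorem isCompact_corner : IsCompact (corner m) := by
  refine ((isCompact_stdSimplex ℝ (Option (Fin m))).image (f := fun w =>
    WithLp.toLp 2 fun j => w (some j)) (by fun_prop)).of_isClosed_subset isClosed_corner ?_
  intro y hy
  refine ⟨fun o => o.elim (1 - ∑ j, y j) y, ⟨?_, ?_⟩, rfl⟩
  · rintro (_ | j)
    exacts [sub_nonneg.2 hy.2, hy.1 j]
  · simp [Fintype.sum_option]

theorem isCompact_prodCorner : IsCompact (prodCorner m) := by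
  refine (isCompact_Icc.prod isCompact_corner).of_isClosed_subset
    (s := Icc (0 : ℝ) 1 ×ˢ corner m) ?_ fun z hz => ⟨⟨hz.2.1, hz.2.2.trans ?_⟩, hz.1⟩
  · exact (isClosed_corner.preimage continuous_snd).inter ((isClosed_le continuous_const
      continuous_fst).inter (isClosed_le continuous_fst (by fun_prop)))
  · exact sub_le_self _ (Finset.sum_nonneg fun j _ => hz.1.1 j)

theorem convexHull_range_eq_image_stdSimplex {ι E : Type*} [Fintype ι] [AddCommGroup E]
    [Module ℝ E] (r : ι → E) :
    convexHull ℝ (range r) = Fintype.linearCombination ℝ r '' stdSimplex ℝ ι := by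
  classical
  rw [← convexHull_rangle_single_eq_stdSimplex, LinearMap.image_convexHull, ← range_comp]
  congr with i
  simp [Fintype.linearCombination_apply]

theorem convexHull_eq_image_corner (p : Vec n) (r : Fin m → Vec n) :
    convexHull ℝ (insert p (range r)) = (fun y => p + edgeMap p r y) '' corner m := by
  rw [← Option.range_elim, convexHull_range_eq_image_stdSimplex]
  ext x
  simp only [mem_image, Fintype.linearCombination_apply, Fintype.sum_option, add_edgeMap_eq,
    Option.elim]
  constructor
  · rintro ⟨w, ⟨hw, hsum⟩, rfl⟩
    rw [Fintype.sum_option] at hsum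
    refine ⟨WithLp.toLp 2 fun j => w (some j), ⟨fun j => hw _, ?_⟩, ?_⟩
    · linarith [hw none]
    · rw [← hsum]
      simp
  · rintro ⟨y, hy, rfl⟩
    refine ⟨fun o => o.elim (1 - ∑ j, y j) y, ⟨?_, ?_⟩, rfl⟩
    · rintro (_ | j)
      exacts [sub_nonneg.2 hy.2, hy.1 j]
    · simp [Fintype.sum_option]

theorem convexHull_eq_image_prodCorner (p q : Vec n) (r : Fin m → Vec n) :
    convexHull ℝ (insert q (insert p (range r))) =
      (fun z : ℝ × Vec m => p + edgeMap p r z.2 + z.1 • (q - p)) '' prodCorner m := by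
  rw [← Option.range_elim, ← Option.range_elim, convexHull_range_eq_image_stdSimplex]
  ext x
  simp only [mem_image, Fintype.linearCombination_apply, Fintype.sum_option, add_edgeMap_eq,
    Option.elim]
  constructor
  · rintro ⟨w, ⟨hw, hsum⟩, rfl⟩
    rw [Fintype.sum_option, Fintype.sum_option] at hsum
    refine ⟨(w none, WithLp.toLp 2 fun j => w (some (some j))),
      ⟨⟨fun j => hw _, ?_⟩, hw _, ?_⟩, ?_⟩
    · linarith [hw none, hw (some none)]
    · linarith [hw (some none)]
    · have hp : w (some none) = 1 - ∑ j, w (some (some j)) - w none := by linarith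
      rw [hp]
      module
  · rintro ⟨⟨s, y⟩, ⟨hy, hs⟩, rfl⟩
    refine ⟨fun o => o.elim s fun o => o.elim (1 - s - ∑ j, y j) y, ⟨?_, ?_⟩, ?_⟩
    · rintro (_ | _ | j)
      exacts [hs.1, sub_nonneg.2 (le_sub_comm.1 hs.2), hy.1 j]
    · simp [Fintype.sum_option]
    · simp only [Option.elim]
      module

end Parametrization

section Integrals

variable {m n : ℕ}

theorem euclideanHausdorffMeasure_convexHull_lt_top (p : Vec n) (r : Fin m → Vec n) :
    (Measure.euclideanHausdorffMeasure m : Measure (Vec n)) (convexHull ℝ (insert p (range r)))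
      < ⊤ := by
  have himage := (edgeMap p r).euclideanHausdorffMeasure_image_eq_normDet_mul_volume (corner m)
  rw [finrank_euclideanSpace_fin] at himage
  rw [convexHull_eq_image_corner, ← image_image (fun x => p + x) (edgeMap p r),
    (isometry_add_left p).euclideanHausdorffMeasure_image, himage]
  exact ENNReal.mul_lt_top ENNReal.ofReal_lt_top isCompact_corner.measure_lt_top

variable {p q : Vec (m + 1)} {r : Fin m → Vec (m + 1)} {ν : Vec (m + 1)}

theorem faceIntegral_eq_integral_corner {F : Finset (Vec (m + 1))}
    (hF : (F : Set (Vec (m + 1))) = insert p (range r)) {g : Vec (m + 1) → ℝ}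
    (hg : Continuous g) :
    faceIntegral F g = (edgeMap p r).normDet * ∫ y in corner m, g (p + edgeMap p r y) := by
  rw [faceIntegral, hF, convexHull_eq_image_corner, Nat.add_sub_cancel,
    euclideanHausdorffMeasure_restrict_affine_image, integral_smul_measure,
    ENNReal.toReal_ofReal (LinearMap.normDet_nonneg _),
    integral_map (by fun_prop) hg.aestronglyMeasurable, smul_eq_mul]

theorem injective_cell_parametrization (hν : ν ≠ 0) (hL : (edgeMap p r).range = (ℝ ∙ ν)ᗮ)
    (he : inner ℝ ν (q - p) ≠ 0) :
    Function.Injective fun z : ℝ × Vec m => p + edgeMap p r z.2 + z.1 • (q - p) := by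
  have : Fact (Module.finrank ℝ (Vec (m + 1)) = m + 1) := ⟨finrank_euclideanSpace_fin⟩
  have hinj : Function.Injective (edgeMap p r) := by
    have hrank := (edgeMap p r).finrank_range_add_finrank_ker
    rw [hL, Submodule.finrank_orthogonal_span_singleton (n := m) hν,
      finrank_euclideanSpace_fin] at hrank
    exact LinearMap.ker_eq_bot.1 (Submodule.finrank_eq_zero.1 (by omega))
  have horth : ∀ y, inner ℝ ν (edgeMap p r y) = 0 := fun y =>
    Submodule.mem_orthogonal_singleton_iff_inner_right.1 (hL ▸ LinearMap.mem_range_self _ y)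
  intro z z' h
  have hinner := congrArg (inner ℝ ν) h
  simp only [inner_add_right, horth, inner_smul_right, add_zero] at hinner
  have hfst : z.1 = z'.1 := mul_right_cancel₀ he (by linarith)
  simp only [hfst, add_left_inj, add_right_inj] at h
  exact Prod.ext hfst (hinj h)

theorem setIntegral_cell (hν : ‖ν‖ = 1) (hL : (edgeMap p r).range = (ℝ ∙ ν)ᗮ)
    (he : inner ℝ ν (q - p) ≠ 0) {g : Vec (m + 1) → ℝ} (hg : Continuous g) :
    ∫ x in convexHull ℝ (insert q (insert p (range r))), g x =
      (edgeMap p r).normDet * |inner ℝ ν (q - p)| *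
        ∫ z in prodCorner m, g (p + edgeMap p r z.2 + z.1 • (q - p)) := by
  have hcont : Continuous fun z : ℝ × Vec m => p + edgeMap p r z.2 + z.1 • (q - p) := by fun_prop
  have hν0 : ν ≠ 0 := norm_ne_zero_iff.1 (hν ▸ one_ne_zero)
  rw [convexHull_eq_image_prodCorner, volume_eq_smul_map_transversal (edgeMap p r) p hν hL he,
    Measure.restrict_smul, integral_smul_measure,
    ENNReal.toReal_ofReal (mul_nonneg (LinearMap.normDet_nonneg _) (abs_nonneg _)),
    setIntegral_map (isCompact_prodCorner.image hcont).measurableSet hg.aestronglyMeasurable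
      hcont.aemeasurable,
    preimage_image_eq _ (injective_cell_parametrization hν0 hL he), smul_eq_mul]
  rfl

/-- The volume of a simplex does not depend on which facet is taken as its base. -/
theorem normDet_edgeMap_mul_abs_inner_comm {νp νq : Vec (m + 1)} (hνp : ‖νp‖ = 1)
    (hLp : (edgeMap q r).range = (ℝ ∙ νp)ᗮ) (hep : inner ℝ νp (p - q) ≠ 0) (hνq : ‖νq‖ = 1)
    (hLq : (edgeMap p r).range = (ℝ ∙ νq)ᗮ) (heq : inner ℝ νq (q - p) ≠ 0)
    (hpos : 0 < volume.real (convexHull ℝ (insert q (insert p (range r))))) :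
    (edgeMap q r).normDet * |inner ℝ νp (p - q)| =
      (edgeMap p r).normDet * |inner ℝ νq (q - p)| := by
  have hq := setIntegral_cell hνq hLq heq (continuous_const (y := (1 : ℝ)))
  have hp := setIntegral_cell hνp hLp hep (continuous_const (y := (1 : ℝ)))
  rw [insert_comm, hq] at hp
  refine (mul_right_cancel₀ (fun hzero => ?_) hp).symm
  rw [hzero, mul_zero, setIntegral_const, smul_eq_mul, mul_one] at hq
  exact hpos.ne' hq

theorem integral_prodCorner_deriv {f f' : ℝ × Vec m → ℝ} (hf : Continuous f)
    (hf' : Continuous f') (hderiv : ∀ s y, HasDerivAt (fun s => f (s, y)) (f' (s, y)) s) :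
    ∫ z in prodCorner m, f' z =
      (∫ y in corner m, f (1 - ∑ j, y j, y)) - ∫ y in corner m, f (0, y) := by
  have hmeas : MeasurableSet (prodCorner m) := isCompact_prodCorner.measurableSet
  have hint : IntegrableOn f' (prodCorner m) (volume.prod volume) :=
    hf'.continuousOn.integrableOn_compact isCompact_prodCorner
  have hend : ∀ h : Vec m → ℝ, Continuous h → IntegrableOn (fun y => f (h y, y)) (corner m) :=
    fun h hh => (by fun_prop : Continuous _).continuousOn.integrableOn_compact isCompact_corner
  rw [← integral_sub (hend _ (by fun_prop)) (hend _ continuous_const), ← integral_indicator hmeas,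
    ← integral_indicator isClosed_corner.measurableSet, Measure.volume_eq_prod,
    integral_prod_symm _ (hint.integrable_indicator hmeas)]
  congr with y
  by_cases hy : y ∈ corner m
  · have hslice : (fun s => (prodCorner m).indicator f' (s, y)) =
        (Icc 0 (1 - ∑ j, y j)).indicator fun s => f' (s, y) := by
      ext s
      simp only [indicator, prodCorner, mem_ofPred_eq, hy, true_and]
    rw [hslice, integral_indicator measurableSet_Icc, indicator_of_mem hy,
      integral_Icc_eq_integral_Ioc, ← intervalIntegral.integral_of_le (by linarith [hy.2])]
    exact intervalIntegral.integral_eq_sub_of_hasDerivAt (fun s _ => hderiv s y)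
      ((by fun_prop : Continuous fun s => f' (s, y)).intervalIntegrable _ _)
  · simp only [indicator, prodCorner, mem_ofPred_eq, hy, false_and, if_false, integral_zero]

theorem setIntegral_fderiv_cell_edge (hν : ‖ν‖ = 1) (hL : (edgeMap p r).range = (ℝ ∙ ν)ᗮ)
    (he : inner ℝ ν (q - p) ≠ 0) {g : Vec (m + 1) → ℝ} (hg : ContDiff ℝ 1 g) :
    ∫ x in convexHull ℝ (insert q (insert p (range r))), fderiv ℝ g x (q - p) =
      (edgeMap p r).normDet * |inner ℝ ν (q - p)| *
        ((∫ y in corner m, g (q + edgeMap q r y)) - ∫ y in corner m, g (p + edgeMap p r y)) := by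
  have hgc := hg.continuous
  have hg' : Continuous fun x => fderiv ℝ g x (q - p) :=
    (hg.continuous_fderiv one_ne_zero).clm_apply continuous_const
  have hftc := integral_prodCorner_deriv (m := m)
    (f := fun z => g (p + edgeMap p r z.2 + z.1 • (q - p)))
    (f' := fun z => fderiv ℝ g (p + edgeMap p r z.2 + z.1 • (q - p)) (q - p))
    (by fun_prop) (hg'.comp (by fun_prop)) fun s y =>
      ((hg.differentiable one_ne_zero _).hasFDerivAt).comp_hasDerivAt s <| by
        simpa using ((hasDerivAt_id s).smul_const (q - p)).const_add (p + edgeMap p r y)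
  have hopposite : ∀ y : Vec m,
      p + edgeMap p r y + (1 - ∑ j, y j) • (q - p) = q + edgeMap q r y := by
    intro y
    simp only [add_edgeMap_eq]
    module
  simp only [hopposite, zero_smul, add_zero] at hftc
  rw [setIntegral_cell hν hL he hg', hftc]

end Integrals

section FaceIntegral

variable {d : ℕ} {F : Finset (Vec d)}

theorem exists_eq_insert_range [DecidableEq (Vec d)] {p : Vec d} {m : ℕ} (hp : p ∈ F)
    (hF : F.card = m + 1) :
    ∃ r : Fin m → Vec d, range r = (F.erase p : Set (Vec d)) ∧
      (F : Set (Vec d)) = insert p (range r) := by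
  have hcard : (F.erase p).card = m := by simp [Finset.card_erase_of_mem hp, hF]
  have hrange : range (fun j => (((F.erase p).equivFinOfCardEq hcard).symm j : Vec d)) =
      (F.erase p : Set (Vec d)) := by
    rw [range_comp' (fun x : {x // x ∈ F.erase p} => (x : Vec d)), Equiv.range_eq_univ, image_univ,
      Subtype.range_coe_subtype]
    rfl
  exact ⟨_, hrange, by rw [hrange, ← Finset.coe_insert, Finset.insert_erase hp]⟩

theorem isCompact_convexHull_finset (F : Finset (Vec d)) :
    IsCompact (convexHull ℝ (F : Set (Vec d))) :=
  F.finite_toSet.isCompact_convexHull ℝ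

theorem integrableOn_convexHull {g : Vec d → ℝ} (hg : Continuous g) (T : Finset (Vec d)) :
    IntegrableOn g (convexHull ℝ (T : Set (Vec d))) :=
  hg.continuousOn.integrableOn_compact (isCompact_convexHull_finset T)

theorem euclideanHausdorffMeasure_facet_lt_top (hF : F.card = d) :
    (Measure.euclideanHausdorffMeasure (d - 1) : Measure (Vec d))
      (convexHull ℝ (F : Set (Vec d))) < ⊤ := by
  classical
  obtain rfl | ⟨p, hp⟩ := F.eq_empty_or_nonempty
  · simp
  obtain ⟨r, -, hr⟩ := exists_eq_insert_range (m := d - 1) hp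
    (by have := Finset.card_pos.2 ⟨p, hp⟩; omega)
  rw [hr]
  exact euclideanHausdorffMeasure_convexHull_lt_top p r

theorem integrableOn_facet (hF : F.card = d) {g : Vec d → ℝ} (hg : Continuous g) :
    IntegrableOn g (convexHull ℝ (F : Set (Vec d)))
      (Measure.euclideanHausdorffMeasure (d - 1)) :=
  hg.continuousOn.integrableOn_of_subset_isCompact (isCompact_convexHull_finset F)
    (isCompact_convexHull_finset F).measurableSet subset_rfl
    (euclideanHausdorffMeasure_facet_lt_top hF).ne

theorem faceIntegral_add (hF : F.card = d) {g h : Vec d → ℝ} (hg : Continuous g)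
    (hh : Continuous h) :
    faceIntegral F (fun x => g x + h x) = faceIntegral F g + faceIntegral F h :=
  integral_add (integrableOn_facet hF hg) (integrableOn_facet hF hh)

theorem faceIntegral_sum (hF : F.card = d) {ι : Type*} (s : Finset ι) {g : ι → Vec d → ℝ}
    (hg : ∀ i ∈ s, Continuous (g i)) :
    faceIntegral F (fun x => ∑ i ∈ s, g i x) = ∑ i ∈ s, faceIntegral F (g i) :=
  integral_finsetSum s fun i hi => integrableOn_facet hF (hg i hi)

theorem faceIntegral_const_mul (F : Finset (Vec d)) (c : ℝ) (g : Vec d → ℝ) :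
    faceIntegral F (fun x => c * g x) = c * faceIntegral F g :=
  integral_const_mul c g

theorem faceIntegral_congr {g h : Vec d → ℝ}
    (hgh : ∀ x ∈ convexHull ℝ (F : Set (Vec d)), g x = h x) :
    faceIntegral F g = faceIntegral F h :=
  setIntegral_congr_fun (isCompact_convexHull_finset F).measurableSet hgh

end FaceIntegral

section Divergence

variable {d : ℕ} {T : Finset (Vec d)}

theorem IsSimplex.volume_pos (hT : IsSimplex T) :
    0 < volume.real (convexHull ℝ (T : Set (Vec d))) := by
  refine ENNReal.toReal_pos ?_ (isCompact_convexHull_finset T).measure_lt_top.ne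
  have hne := interior_convexHull_nonempty_iff_affineSpan_eq_top.2 hT.affineSpan_eq_top
  exact ((isOpen_interior.measure_pos _ hne).trans_le (measure_mono interior_subset)).ne'

theorem divergence_eq_sum {w : Vec d → Vec d} {x : Vec d} (hw : DifferentiableAt ℝ w x) :
    divergence w x = ∑ i, fderiv ℝ (fun y => w y i) x (EuclideanSpace.single i 1) := by
  rw [divergence, Matrix.trace]
  refine Finset.sum_congr rfl fun i _ => ?_
  have hcomp := ((EuclideanSpace.proj i : Vec d →L[ℝ] ℝ).hasFDerivAt.comp x hw.hasFDerivAt).fderiv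
  exact (congrArg (fun A => A (EuclideanSpace.single i 1)) hcomp).symm

variable [DecidableEq (Vec d)]

theorem IsSimplex.setIntegral_fderiv_edge (hT : IsSimplex T) {p q : Vec d} (hp : p ∈ T)
    (hq : q ∈ T) (hpq : p ≠ q) {g : Vec d → ℝ} (hg : ContDiff ℝ 1 g) :
    ∫ x in convexHull ℝ (T : Set (Vec d)), fderiv ℝ g x (q - p) =
      inner ℝ (outerNormal T (T.erase p)) (q - p) * faceIntegral (T.erase p) g +
      inner ℝ (outerNormal T (T.erase q)) (q - p) * faceIntegral (T.erase q) g := by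
  have hqF : q ∈ T.erase p := Finset.mem_erase.2 ⟨hpq.symm, hq⟩
  have hpF : p ∈ T.erase q := Finset.mem_erase.2 ⟨hpq, hp⟩
  obtain ⟨m, rfl⟩ : ∃ m, d = m + 1 := Nat.exists_eq_succ_of_ne_zero
    (hT.card_erase hp ▸ Finset.card_ne_zero_of_mem hqF)
  obtain ⟨r, hr, hFp⟩ := exists_eq_insert_range hqF (hT.card_erase hp)
  have hFq : (T.erase q : Set (Vec (m + 1))) = insert p (range r) := by
    rw [hr, ← Finset.coe_insert, Finset.erase_right_comm, Finset.insert_erase hpF]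
  have hTq : (T : Set (Vec (m + 1))) = insert q (insert p (range r)) := by
    rw [← hFq, ← Finset.coe_insert, Finset.insert_erase hq]
  have hνp := norm_outerNormal hT.affineIndependent hp ⟨q, hqF⟩
  have hνq := norm_outerNormal hT.affineIndependent hq ⟨p, hpF⟩
  have hip := inner_outerNormal_sub_neg hT.affineIndependent hp (subset_affineSpan ℝ _ hqF)
  have hiq := inner_outerNormal_sub_neg hT.affineIndependent hq (subset_affineSpan ℝ _ hpF)
  have hLp := hT.vectorSpan_erase hp ⟨q, hqF⟩
  have hLq := hT.vectorSpan_erase hq ⟨p, hpF⟩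
  rw [hFp, ← range_edgeMap] at hLp
  rw [hFq, ← range_edgeMap] at hLq
  have hheights := normDet_edgeMap_mul_abs_inner_comm hνp hLp hip.ne hνq hLq hiq.ne
    (hTq ▸ hT.volume_pos)
  rw [abs_of_neg hiq, abs_of_neg hip, ← neg_sub q p, inner_neg_right] at hheights
  rw [hTq, setIntegral_fderiv_cell_edge hνq hLq hiq.ne hg,
    faceIntegral_eq_integral_corner hFp hg.continuous,
    faceIntegral_eq_integral_corner hFq hg.continuous, abs_of_neg hiq]
  linear_combination -(∫ y in corner m, g (q + edgeMap q r y)) * hheights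

/-- Both sides are linear in `e`, so it suffices to take for `e` the edges issuing from one
vertex; the facets containing an edge do not contribute to its right-hand side. -/
theorem IsSimplex.setIntegral_fderiv (hT : IsSimplex T) {g : Vec d → ℝ} (hg : ContDiff ℝ 1 g)
    (e : Vec d) :
    ∫ x in convexHull ℝ (T : Set (Vec d)), fderiv ℝ g x e =
      ∑ v ∈ T, inner ℝ (outerNormal T (T.erase v)) e * faceIntegral (T.erase v) g := by
  have hint : IntegrableOn (fderiv ℝ g) (convexHull ℝ (T : Set (Vec d))) :=
    (hg.continuous_fderiv one_ne_zero).continuousOn.integrableOn_compact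
      (isCompact_convexHull_finset T)
  set L : Vec d →L[ℝ] ℝ := ∫ x in convexHull ℝ (T : Set (Vec d)), fderiv ℝ g x
  set R : Vec d →L[ℝ] ℝ := ∑ v ∈ T,
    faceIntegral (T.erase v) g • innerSL ℝ (outerNormal T (T.erase v))
  have hL_apply : ∀ e, L e = ∫ x in convexHull ℝ (T : Set (Vec d)), fderiv ℝ g x e :=
    ContinuousLinearMap.integral_apply hint
  have hR_apply : ∀ e, R e =
      ∑ v ∈ T, inner ℝ (outerNormal T (T.erase v)) e * faceIntegral (T.erase v) g := fun e => by
    simp [R, mul_comm]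
  obtain ⟨p, hp⟩ : T.Nonempty := Finset.card_pos.1 (hT.card_eq ▸ d.succ_pos)
  have hspan : Submodule.span ℝ ((· -ᵥ p) '' (T : Set (Vec d))) = ⊤ := by
    rw [← vectorSpan_eq_span_vsub_set_right ℝ (Finset.mem_coe.2 hp), ← direction_affineSpan,
      hT.affineSpan_eq_top, AffineSubspace.direction_top]
  have hedge : ∀ q ∈ T, L (q - p) = R (q - p) := by
    intro q hq
    obtain rfl | hpq := eq_or_ne p q
    · simp
    rw [hL_apply, hR_apply, hT.setIntegral_fderiv_edge hp hq hpq hg, ← Finset.sum_pair hpq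
      (f := fun v => inner ℝ (outerNormal T (T.erase v)) (q - p) * faceIntegral (T.erase v) g)]
    refine Finset.sum_subset (by simp [Finset.insert_subset_iff, hp, hq]) fun v _ hvpq => ?_
    simp only [Finset.mem_insert, Finset.mem_singleton, not_or] at hvpq
    rw [inner_outerNormal_sub_eq_zero T
      (subset_affineSpan ℝ _ (Finset.mem_erase.2 ⟨Ne.symm hvpq.2, hq⟩))
      (subset_affineSpan ℝ _ (Finset.mem_erase.2 ⟨Ne.symm hvpq.1, hp⟩)), zero_mul]
  have hLR : (L : Vec d →ₗ[ℝ] ℝ) = R :=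
    LinearMap.ext_on hspan (forall_mem_image.2 hedge)
  rw [← hL_apply, ← hR_apply]
  exact LinearMap.congr_fun hLR e

theorem IsSimplex.setIntegral_divergence (hT : IsSimplex T) {w : Vec d → Vec d}
    (hw : ContDiff ℝ 1 w) :
    ∫ x in convexHull ℝ (T : Set (Vec d)), divergence w x =
      ∑ v ∈ T, faceIntegral (T.erase v)
        (fun x => inner ℝ (w x) (outerNormal T (T.erase v))) := by
  have hwi : ∀ i, ContDiff ℝ 1 fun y => w y i := contDiff_euclidean.1 hw
  calc ∫ x in convexHull ℝ (T : Set (Vec d)), divergence w x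
      = ∑ i, ∫ x in convexHull ℝ (T : Set (Vec d)),
          fderiv ℝ (fun y => w y i) x (EuclideanSpace.single i 1) := by
        simp only [divergence_eq_sum (hw.differentiable one_ne_zero _)]
        exact integral_finsetSum _ fun i _ => integrableOn_convexHull
          (((hwi i).continuous_fderiv one_ne_zero).clm_apply continuous_const) T
    _ = ∑ v ∈ T, ∑ i, outerNormal T (T.erase v) i * faceIntegral (T.erase v) fun y => w y i := by
        rw [Finset.sum_comm]
        refine Finset.sum_congr rfl fun i _ => ?_
        rw [hT.setIntegral_fderiv (hwi i)]
        simp [EuclideanSpace.inner_single_right]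
    _ = ∑ v ∈ T, faceIntegral (T.erase v)
          (fun x => inner ℝ (w x) (outerNormal T (T.erase v))) := by
        refine Finset.sum_congr rfl fun v hv => ?_
        simp only [← faceIntegral_const_mul]
        rw [← faceIntegral_sum (hT.card_erase hv) Finset.univ
          (g := fun i y => outerNormal T (T.erase v) i * w y i)
          fun i _ => continuous_const.mul (hwi i).continuous]
        simp [PiLp.inner_apply]

end Divergence

/-! ### Facets of a conforming triangulation -/

section Barycentric

open Filter Topology

variable {d : ℕ} {T F S : Finset (Vec d)}

/-- The vertices of a simplex as an affine basis, whose coordinates are the barycentric coordinates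
of the simplex. -/
def IsSimplex.affineBasis (hT : IsSimplex T) : AffineBasis {x // x ∈ T} ℝ (Vec d) :=
  ⟨Subtype.val, hT.affineIndependent, by
    rw [Subtype.range_coe_subtype]
    exact hT.affineSpan_eq_top⟩

theorem IsSimplex.affineBasis_apply (hT : IsSimplex T) {w : Vec d} (hw : w ∈ T) :
    hT.affineBasis ⟨w, hw⟩ = w :=
  rfl

theorem IsSimplex.range_affineBasis (hT : IsSimplex T) :
    range hT.affineBasis = (T : Set (Vec d)) :=
  Subtype.range_coe_subtype

theorem IsSimplex.coord_nonneg (hT : IsSimplex T) (v : {x // x ∈ T}) {x : Vec d}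
    (hx : x ∈ convexHull ℝ (T : Set (Vec d))) : 0 ≤ hT.affineBasis.coord v x := by
  rw [← hT.range_affineBasis, AffineBasis.convexHull_eq_nonneg_coord] at hx
  exact hx v

theorem IsSimplex.mem_interior_convexHull_iff (hT : IsSimplex T) {x : Vec d} :
    x ∈ interior (convexHull ℝ (T : Set (Vec d))) ↔ ∀ v, 0 < hT.affineBasis.coord v x := by
  rw [← hT.range_affineBasis, AffineBasis.interior_convexHull]
  rfl

theorem IsSimplex.coord_eq_zero (hT : IsSimplex T) (hST : S ⊆ T) {v : {x // x ∈ T}}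
    (hv : v.1 ∉ S) {x : Vec d} (hx : x ∈ convexHull ℝ (S : Set (Vec d))) :
    hT.affineBasis.coord v x = 0 := by
  have hconvex := (convex_singleton (0 : ℝ)).affine_preimage (hT.affineBasis.coord v)
  refine convexHull_min (fun w hw => ?_) hconvex hx
  have hvw : v ≠ ⟨w, hST hw⟩ := fun h => hv (h ▸ hw)
  rw [mem_preimage, mem_singleton_iff, ← hT.affineBasis_apply (hST hw)]
  exact hT.affineBasis.coord_apply_ne hvw

theorem IsSimplex.coord_centroid (hT : IsSimplex T) (hFT : F ⊆ T) {v : {x // x ∈ T}}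
    (hv : v.1 ∈ F) : hT.affineBasis.coord v (F.centroid ℝ id) = (F.card : ℝ)⁻¹ := by
  classical
  have hweights : ∑ w ∈ F, F.centroidWeights ℝ w = 1 :=
    F.sum_centroidWeights_eq_one_of_nonempty ℝ ⟨v, hv⟩
  have hcoord : ∀ w ∈ F, hT.affineBasis.coord v w = if w = v then 1 else 0 := fun w hw => by
    rw [← hT.affineBasis_apply (hFT hw), AffineBasis.coord_apply]
    simp only [Subtype.ext_iff, eq_comm, hT.affineBasis_apply]
  rw [Finset.centroid_def, Finset.map_affineCombination _ _ _ hweights,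
    Finset.affineCombination_eq_linear_combination _ _ _ hweights]
  simp only [Function.comp_apply, id, Finset.centroidWeights_apply, smul_eq_mul]
  rw [← Finset.mul_sum, Finset.sum_congr rfl hcoord, Finset.sum_ite_eq', if_pos hv, mul_one]

theorem IsSimplex.exists_eq_erase [DecidableEq (Vec d)] (hT : IsSimplex T) (hFT : F ⊆ T)
    (hF : F.card = d) : ∃ q ∈ T, F = T.erase q := by
  obtain ⟨q, hq, rfl⟩ := Finset.exists_eq_insert_iff.2 ⟨hFT, by rw [hF, hT.card_eq]⟩
  exact ⟨q, Finset.mem_insert_self _ _, (Finset.erase_insert hq).symm⟩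

theorem IsSimplex.lineMap_centroid_notMem_convexHull (hT : IsSimplex T) (hFT : F ⊆ T)
    (hST : S ⊆ T) (hFS : ¬ F ⊆ S) {x : Vec d} (hx : x ∈ convexHull ℝ (F : Set (Vec d))) {δ : ℝ}
    (hδ : δ ∈ Ioc 0 1) :
    AffineMap.lineMap x (F.centroid ℝ id) δ ∉ convexHull ℝ (S : Set (Vec d)) := by
  obtain ⟨f, hfF, hfS⟩ := Finset.not_subset.1 hFS
  intro hmem
  have hzero := hT.coord_eq_zero (v := ⟨f, hFT hfF⟩) hST hfS hmem
  have hnonneg := hT.coord_nonneg ⟨f, hFT hfF⟩ (convexHull_mono (Finset.coe_subset.2 hFT) hx)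
  have hpos : (0 : ℝ) < (F.card : ℝ)⁻¹ :=
    inv_pos.2 (Nat.cast_pos.2 (Finset.card_pos.2 ⟨f, hfF⟩))
  rw [AffineMap.apply_lineMap, hT.coord_centroid hFT hfF, AffineMap.lineMap_apply_ring] at hzero
  nlinarith [hδ.1, hδ.2, mul_pos hδ.1 hpos, mul_nonneg (sub_nonneg.2 hδ.2) hnonneg]

theorem IsSimplex.coord_linear_outerNormal_neg [DecidableEq (Vec d)] (hT : IsSimplex T)
    (q : {x // x ∈ T}) (hF : (T.erase q).Nonempty) :
    (hT.affineBasis.coord q).linear (outerNormal T (T.erase q)) < 0 := by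
  obtain ⟨p, hp⟩ := hF
  set ν := outerNormal T (T.erase q)
  set l := (hT.affineBasis.coord q).linear
  have hν : ‖ν‖ = 1 := norm_outerNormal hT.affineIndependent q.2 ⟨p, hp⟩
  have hneg : inner ℝ ν (q - p) < 0 :=
    inner_outerNormal_sub_neg hT.affineIndependent q.2 (subset_affineSpan ℝ _ hp)
  have hp0 : hT.affineBasis.coord q p = 0 :=
    hT.coord_eq_zero (Finset.erase_subset _ _) (Finset.notMem_erase _ _) (subset_convexHull ℝ _ hp)
  have hq1 : hT.affineBasis.coord q q = 1 := hT.affineBasis.coord_apply_eq q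
  have hker : vectorSpan ℝ (T.erase q : Set (Vec d)) ≤ l.ker := by
    rw [vectorSpan_def, Submodule.span_le]
    rintro _ ⟨x, hx, y, hy, rfl⟩
    have hface : ∀ z ∈ (T.erase q : Set (Vec d)), hT.affineBasis.coord q z = 0 := fun z hz =>
      hT.coord_eq_zero (Finset.erase_subset _ _) (Finset.notMem_erase _ _)
        (subset_convexHull ℝ _ hz)
    rw [SetLike.mem_coe, LinearMap.mem_ker, AffineMap.linearMap_vsub, hface x hx, hface y hy,
      vsub_self]
  have htangent : ((q : Vec d) - p) - inner ℝ ν (q - p) • ν ∈ l.ker := by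
    refine hker ?_
    rw [hT.vectorSpan_erase q.2 ⟨p, hp⟩, Submodule.mem_orthogonal_singleton_iff_inner_right,
      inner_sub_right, inner_smul_right, real_inner_self_eq_norm_sq, hν]
    ring
  have hone : l ((q : Vec d) - p) = 1 := by
    rw [← vsub_eq_sub, AffineMap.linearMap_vsub, hp0, hq1, vsub_eq_sub, sub_zero]
  rw [LinearMap.mem_ker, map_sub, map_smul, hone, smul_eq_mul, sub_eq_zero] at htangent
  exact neg_of_mul_pos_right (htangent ▸ one_pos) hneg.le

theorem IsSimplex.eventually_centroid_sub_smul_outerNormal_mem [DecidableEq (Vec d)]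
    (hT : IsSimplex T) {q : Vec d} (hq : q ∈ T) (hF : (T.erase q).Nonempty) :
    ∀ᶠ ε : ℝ in 𝓝[>] 0, (T.erase q).centroid ℝ id - ε • outerNormal T (T.erase q) ∈
      convexHull ℝ (T : Set (Vec d)) := by
  set c := (T.erase q).centroid ℝ id
  set ν := outerNormal T (T.erase q)
  have hcoord : ∀ v (ε : ℝ), hT.affineBasis.coord v (c - ε • ν) =
      hT.affineBasis.coord v c - ε * (hT.affineBasis.coord v).linear ν := fun v ε => by
    rw [sub_eq_neg_add, ← vadd_eq_add, AffineMap.map_vadd, map_neg, map_smul, vadd_eq_add,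
      smul_eq_mul, neg_add_eq_sub]
  have hpos : ∀ v, ∀ᶠ ε : ℝ in 𝓝[>] 0, 0 < hT.affineBasis.coord v (c - ε • ν) := by
    intro v
    simp only [hcoord]
    obtain hvq | hvq := eq_or_ne v.1 q
    · obtain rfl := hvq
      have hc : hT.affineBasis.coord v c = 0 := hT.coord_eq_zero (Finset.erase_subset _ _)
        (Finset.notMem_erase _ _) (Finset.centroid_mem_convexHull _ hF)
      filter_upwards [self_mem_nhdsWithin] with ε hε
      rw [hc, zero_sub, neg_pos]
      exact mul_neg_of_pos_of_neg hε (hT.coord_linear_outerNormal_neg v hF)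
    · have hc : 0 < hT.affineBasis.coord v c := by
        rw [hT.coord_centroid (Finset.erase_subset _ _) (Finset.mem_erase.2 ⟨hvq, v.2⟩)]
        exact inv_pos.2 (Nat.cast_pos.2 (Finset.card_pos.2 hF))
      have htendsto : Tendsto (fun ε : ℝ => hT.affineBasis.coord v c -
          ε * (hT.affineBasis.coord v).linear ν) (𝓝 0) (𝓝 (hT.affineBasis.coord v c)) :=
        Continuous.tendsto' (by fun_prop) _ _ (by simp)
      exact nhdsWithin_le_nhds (htendsto.eventually_const_lt hc)
  filter_upwards [eventually_all.2 hpos] with ε hε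
  exact interior_subset (hT.mem_interior_convexHull_iff.2 hε)

theorem outerNormal_eq_or_eq_neg {T₁ T₂ : Finset (Vec d)} (h₁ : IsSimplex T₁)
    (h₂ : IsSimplex T₂) (hF₁ : F ⊆ T₁) (hF₂ : F ⊆ T₂) (hF : F.card = d) (hne : F.Nonempty) :
    outerNormal T₂ F = outerNormal T₁ F ∨ outerNormal T₂ F = -outerNormal T₁ F := by
  classical
  obtain ⟨a, ha, hFa⟩ := h₁.exists_eq_erase hF₁ hF
  obtain ⟨b, hb, hFb⟩ := h₂.exists_eq_erase hF₂ hF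
  have hspan₁ := h₁.vectorSpan_erase ha (hFa ▸ hne)
  have hspan₂ := h₂.vectorSpan_erase hb (hFb ▸ hne)
  have hnorm₁ := norm_outerNormal h₁.affineIndependent ha (hFa ▸ hne)
  have hnorm₂ := norm_outerNormal h₂.affineIndependent hb (hFb ▸ hne)
  rw [← hFa] at hspan₁ hnorm₁
  rw [← hFb] at hspan₂ hnorm₂
  have hmem : outerNormal T₂ F ∈ ℝ ∙ outerNormal T₁ F := by
    rw [← Submodule.orthogonal_orthogonal (ℝ ∙ outerNormal T₁ F), ← hspan₁, hspan₂,
      Submodule.orthogonal_orthogonal]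
    exact Submodule.mem_span_singleton_self _
  obtain ⟨c, hc⟩ := Submodule.mem_span_singleton.1 hmem
  rw [← hc, norm_smul, hnorm₁, mul_one, Real.norm_eq_abs] at hnorm₂
  rw [← hc]
  obtain rfl | rfl := eq_or_eq_neg_of_abs_eq hnorm₂
  · exact .inl (one_smul _ _)
  · exact .inr (neg_one_smul _ _)

end Barycentric

section Skeleton

open Filter Topology

variable {d : ℕ} {Ω : Set (Vec d)} {M : Triangulation d Ω} {F : Finset (Vec d)}

theorem Triangulation.isSimplex {T : Finset (Vec d)} (hT : T ∈ M.cells) : IsSimplex T :=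
  ⟨M.card_eq T hT, M.affineIndependent T hT⟩

theorem convexHull_inter_convexHull_subset_facet {T₁ T₂ : Finset (Vec d)} (h₁ : T₁ ∈ M.cells)
    (h₂ : T₂ ∈ M.cells) (hne : T₁ ≠ T₂) (hF₁ : F ⊆ T₁) (hF₂ : F ⊆ T₂) (hF : F.card = d) :
    convexHull ℝ (T₁ : Set (Vec d)) ∩ convexHull ℝ (T₂ : Set (Vec d)) ⊆
      convexHull ℝ (F : Set (Vec d)) := by
  classical
  obtain ⟨S, hS₁, hS₂, hS⟩ := M.conforming T₁ h₁ T₂ h₂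
  have hinter : F = T₁ ∩ T₂ := by
    refine Finset.eq_of_subset_of_card_le (Finset.subset_inter hF₁ hF₂) ?_
    have hlt : (T₁ ∩ T₂).card < T₁.card := Finset.card_lt_card <|
      Finset.inter_subset_left.ssubset_of_ne fun h => hne <| Finset.eq_of_subset_of_card_le
        (Finset.inter_eq_left.1 h) (by rw [M.card_eq T₁ h₁, M.card_eq T₂ h₂])
    rw [M.card_eq T₁ h₁] at hlt
    omega
  rw [hS, hinter]
  exact convexHull_mono (Finset.coe_subset.2 (Finset.subset_inter hS₁ hS₂))

/-- If the normals agreed, the cells would overlap on the inner side of their common facet. -/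
theorem outerNormal_eq_neg {T₁ T₂ : Finset (Vec d)} (h₁ : T₁ ∈ M.cells) (h₂ : T₂ ∈ M.cells)
    (hne : T₁ ≠ T₂) (hF₁ : F ⊆ T₁) (hF₂ : F ⊆ T₂) (hF : F.card = d) (hFne : F.Nonempty) :
    outerNormal T₂ F = -outerNormal T₁ F := by
  classical
  have hs₁ := M.isSimplex h₁
  have hs₂ := M.isSimplex h₂
  refine (outerNormal_eq_or_eq_neg hs₁ hs₂ hF₁ hF₂ hF hFne).resolve_left fun heq => ?_
  obtain ⟨a, ha, hFa⟩ := hs₁.exists_eq_erase hF₁ hF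
  obtain ⟨b, hb, hFb⟩ := hs₂.exists_eq_erase hF₂ hF
  have hin₁ := hs₁.eventually_centroid_sub_smul_outerNormal_mem ha (hFa ▸ hFne)
  have hin₂ := hs₂.eventually_centroid_sub_smul_outerNormal_mem hb (hFb ▸ hFne)
  have hnorm := norm_outerNormal hs₁.affineIndependent ha (hFa ▸ hFne)
  rw [← hFa] at hin₁ hnorm
  rw [← hFb, heq] at hin₂
  obtain ⟨ε, ⟨hε₁, hε₂⟩, hε⟩ := ((hin₁.and hin₂).and self_mem_nhdsWithin).exists
  have hmem := convexHull_inter_convexHull_subset_facet h₁ h₂ hne hF₁ hF₂ hF ⟨hε₁, hε₂⟩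
  have hzero := inner_outerNormal_sub_eq_zero T₁ (convexHull_subset_affineSpan _ hmem)
    (centroid_mem_affineSpan hFne)
  rw [sub_sub_cancel_left, inner_neg_right, inner_smul_right, real_inner_self_eq_norm_sq, hnorm,
    one_pow, mul_one, neg_eq_zero] at hzero
  exact hε.ne' hzero

theorem mem_facets : F ∈ M.facets ↔ ∃ T ∈ M.cells, F ⊆ T ∧ F.card = d := by
  classical
  simp [Triangulation.facets, Finset.mem_powersetCard]

theorem card_of_mem_facets (hF : F ∈ M.facets) : F.card = d := by
  obtain ⟨T, -, -, hcard⟩ := mem_facets.1 hF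
  exact hcard

theorem mem_facets_of_mem_interfaces (hF : F ∈ M.interfaces) : F ∈ M.facets := by
  classical
  exact (Finset.mem_filter.1 hF).1

theorem mem_frontier_of_forall_notMem {T : Finset (Vec d)} (hT : T ∈ M.cells)
    {q p : Vec d} (hq : q ∈ T) (hFT : F ⊆ T) (hqF : q ∉ F)
    (hp : p ∈ convexHull ℝ (F : Set (Vec d)))
    (hother : ∀ T' ∈ M.cells, T' ≠ T → p ∉ convexHull ℝ (T' : Set (Vec d))) :
    p ∈ frontier Ω := by
  have hpT : p ∈ convexHull ℝ (T : Set (Vec d)) := convexHull_mono (Finset.coe_subset.2 hFT) hp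
  refine ⟨M.cover ▸ mem_iUnion₂.2 ⟨T, hT, hpT⟩, fun hpΩ => ?_⟩
  have hmem_nhds : convexHull ℝ (T : Set (Vec d)) ∈ 𝓝 p := by
    have hothers : ∀ᶠ y in 𝓝 p, ∀ T' ∈ M.cells, T' ≠ T → y ∉ convexHull ℝ (T' : Set (Vec d)) :=
      (Finset.eventually_all _).2 fun T' hT' => eventually_imp_distrib_left.2 fun hne =>
        (isCompact_convexHull_finset T').isClosed.isOpen_compl.mem_nhds (hother T' hT' hne)
    filter_upwards [hothers, mem_interior_iff_mem_nhds.1 hpΩ] with y hy hyΩ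
    obtain ⟨T', hT', hyT'⟩ := mem_iUnion₂.1 (M.cover ▸ subset_closure hyΩ)
    by_contra hyT
    exact hy T' hT' (fun h => hyT (h ▸ hyT')) hyT'
  have hpos := (M.isSimplex hT).mem_interior_convexHull_iff.1
    (mem_interior_iff_mem_nhds.2 hmem_nhds) ⟨q, hq⟩
  exact hpos.ne' ((M.isSimplex hT).coord_eq_zero hFT hqF hp)

/-- Moving a point of the facet towards the barycentre of the facet takes it out of all other
cells, hence into `∂Ω`; the point itself is a limit of such points. -/
theorem mem_boundaryFaces_of_notMem_interfaces (hF : F ∈ M.facets)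
    (hFi : F ∉ M.interfaces) : F ∈ M.boundaryFaces := by
  classical
  refine Finset.mem_filter.2 ⟨hF, fun x hx => ?_⟩
  obtain ⟨T, hT, hFT, hcard⟩ := mem_facets.1 hF
  obtain ⟨q, hq, hFq⟩ := (M.isSimplex hT).exists_eq_erase hFT hcard
  have hc : F.centroid ℝ id ∈ convexHull ℝ (F : Set (Vec d)) := F.centroid_mem_convexHull
    (Finset.coe_nonempty.1 (convexHull_nonempty_iff.1 ⟨x, hx⟩))
  have hfrontier : ∀ δ ∈ Ioc (0 : ℝ) 1, AffineMap.lineMap x (F.centroid ℝ id) δ ∈ frontier Ω := by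
    intro δ hδ
    have hmem : AffineMap.lineMap x (F.centroid ℝ id) δ ∈ convexHull ℝ (F : Set (Vec d)) :=
      (convex_convexHull ℝ _).segment_subset hx hc (lineMap_mem_segment ℝ x _ ⟨hδ.1.le, hδ.2⟩)
    refine mem_frontier_of_forall_notMem hT hq hFT (hFq ▸ Finset.notMem_erase q T) hmem ?_
    intro T' hT' hne hmem'
    obtain ⟨S, hST, hST', hS⟩ := M.conforming T hT T' hT'
    refine (M.isSimplex hT).lineMap_centroid_notMem_convexHull hFT hST ?_ hx hδ
      (hS ▸ ⟨convexHull_mono (Finset.coe_subset.2 hFT) hmem, hmem'⟩)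
    exact fun hFS => hFi <|
      Finset.mem_filter.2 ⟨hF, T', hT', T, hT, hne, hFS.trans hST', hFT⟩
  have htendsto : Tendsto (fun δ : ℝ => AffineMap.lineMap x (F.centroid ℝ id) δ) (𝓝[>] 0) (𝓝 x) :=
    (Continuous.tendsto' (by fun_prop) 0 x (AffineMap.lineMap_apply_zero _ _)).mono_left
      nhdsWithin_le_nhds
  exact isClosed_frontier.mem_of_tendsto htendsto
    (eventually_of_mem (Ioc_mem_nhdsGT zero_lt_one) hfrontier)

theorem nonempty_of_mem_interfaces (hF : F ∈ M.interfaces) : F.Nonempty := by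
  classical
  obtain ⟨hFf, T₁, h₁, T₂, h₂, hne, -, -⟩ := Finset.mem_filter.1 hF
  rw [← Finset.card_pos, card_of_mem_facets hFf]
  by_contra! hd
  obtain rfl : d = 0 := by omega
  refine hne (Finset.eq_of_subset_of_card_le (fun x _ => ?_) (by
    rw [M.card_eq T₁ h₁, M.card_eq T₂ h₂]))
  obtain ⟨y, hy⟩ := Finset.card_pos.1 (by rw [M.card_eq T₂ h₂]; exact one_pos)
  rwa [Subsingleton.elim x y]

theorem exists_cellsAt_eq_pair [DecidableEq M.Cell] (hF : F ∈ M.interfaces) :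
    ∃ T₁ T₂ : M.Cell, T₁ ≠ T₂ ∧ M.cellsAt F = {T₁, T₂} ∧
      outerNormal T₂.1 F = -outerNormal T₁.1 F := by
  classical
  have hcard := card_of_mem_facets (mem_facets_of_mem_interfaces hF)
  have hFne := nonempty_of_mem_interfaces hF
  obtain ⟨-, T₁, h₁, T₂, h₂, hne, hF₁, hF₂⟩ := Finset.mem_filter.1 hF
  have h₁₂ := outerNormal_eq_neg h₁ h₂ hne hF₁ hF₂ hcard hFne
  refine ⟨⟨T₁, h₁⟩, ⟨T₂, h₂⟩, fun h => hne (congrArg Subtype.val h), ?_, h₁₂⟩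
  ext ⟨T₃, h₃⟩
  simp only [Triangulation.cellsAt, Finset.mem_filter, Finset.mem_univ, true_and,
    Finset.mem_insert, Finset.mem_singleton, Subtype.mk.injEq]
  refine ⟨fun hF₃ => ?_, ?_⟩
  · by_contra! hne₃
    have h₁₃ := outerNormal_eq_neg h₁ h₃ hne₃.1.symm hF₁ hF₃ hcard hFne
    have h₂₃ := outerNormal_eq_neg h₂ h₃ hne₃.2.symm hF₂ hF₃ hcard hFne
    obtain ⟨q, hq, hFq⟩ := (M.isSimplex h₁).exists_eq_erase hF₁ hcard
    have hnorm := norm_outerNormal (M.affineIndependent T₁ h₁) hq (hFq ▸ hFne)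
    rw [← hFq] at hnorm
    rw [h₁₃, h₁₂, neg_neg, neg_eq_iff_add_eq_zero, ← two_smul ℝ, smul_eq_zero] at h₂₃
    rw [h₂₃.resolve_left two_ne_zero, norm_zero] at hnorm
    exact zero_ne_one hnorm
  · rintro (rfl | rfl) <;> assumption

theorem sum_inner_smul_outerNormal (hF : F ∈ M.interfaces) (a : Broken M ℝ)
    (w : Broken M (Vec d)) (x : Vec d) :
    ∑ T ∈ M.cellsAt F, inner ℝ (a T x • w T x) (outerNormal T.1 F) =
      jumpV w F x * avg a F x + inner ℝ (jump a F x) (avg w F x) := by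
  classical
  obtain ⟨T₁, T₂, hne, hcells, hneg⟩ := exists_cellsAt_eq_pair hF
  rw [jumpV, avg, avg, jump, hcells, Finset.card_pair hne]
  simp only [Finset.sum_pair hne, hneg, inner_add_left, inner_add_right, real_inner_smul_left,
    real_inner_smul_right, inner_neg_right, inner_neg_left, smul_neg, smul_eq_mul]
  rw [real_inner_comm (w T₁ x), real_inner_comm (w T₂ x)]
  push_cast
  ring

theorem sum_erase_eq_sum_facets [DecidableEq (Vec d)] (T : M.Cell) (f : Finset (Vec d) → ℝ) :
    ∑ v ∈ T.1, f (T.1.erase v) = ∑ F ∈ M.facets with F ⊆ T.1, f F := by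
  have hT := M.isSimplex T.2
  have himage : M.facets.filter (fun F => F ⊆ T.1) = T.1.image fun v => T.1.erase v := by
    ext F
    simp only [Finset.mem_filter, Finset.mem_image]
    constructor
    · rintro ⟨hF, hFT⟩
      obtain ⟨q, hq, rfl⟩ := hT.exists_eq_erase hFT (card_of_mem_facets hF)
      exact ⟨q, hq, rfl⟩
    · rintro ⟨v, hv, rfl⟩
      have hsub := Finset.erase_subset v T.1
      exact ⟨mem_facets.2 ⟨T.1, T.2, hsub, hT.card_erase hv⟩, hsub⟩
  rw [himage, Finset.sum_image (Finset.erase_injOn T.1)]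

theorem domainIntegral_divergence (w : Broken M (Vec d)) (hw : ∀ T, ContDiff ℝ 1 (w T)) :
    domainIntegral (M := M) (fun T x => divergence (w T) x) =
      ∑ F ∈ M.facets, faceIntegral F
        (fun x => ∑ T ∈ M.cellsAt F, inner ℝ (w T x) (outerNormal T.1 F)) := by
  classical
  calc domainIntegral (M := M) (fun T x => divergence (w T) x)
      = ∑ T : M.Cell, ∑ F ∈ M.facets with F ⊆ T.1,
          faceIntegral F (fun x => inner ℝ (w T x) (outerNormal T.1 F)) := by
        refine Finset.sum_congr rfl fun T _ => ?_
        rw [(M.isSimplex T.2).setIntegral_divergence (hw T)]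
        exact sum_erase_eq_sum_facets T fun F =>
          faceIntegral F (fun x => inner ℝ (w T x) (outerNormal T.1 F))
    _ = ∑ F ∈ M.facets, ∑ T ∈ M.cellsAt F,
          faceIntegral F (fun x => inner ℝ (w T x) (outerNormal T.1 F)) := by
        simp only [Triangulation.cellsAt, Finset.sum_filter]
        exact Finset.sum_comm
    _ = ∑ F ∈ M.facets, faceIntegral F
          (fun x => ∑ T ∈ M.cellsAt F, inner ℝ (w T x) (outerNormal T.1 F)) :=
        Finset.sum_congr rfl fun F hF => (faceIntegral_sum (card_of_mem_facets hF) _ fun T _ =>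
          (hw T).continuous.inner continuous_const).symm

theorem domainIntegral_divergence_smul {a : Broken M ℝ} {w : Broken M (Vec d)}
    (ha : ∀ T, ContDiff ℝ 1 (a T)) (hw : ∀ T, ContDiff ℝ 1 (w T))
    (hbdry : ∀ F ∈ M.boundaryFaces, ∀ T ∈ M.cellsAt F,
      ∀ x ∈ convexHull ℝ (F : Set (Vec d)), inner ℝ (w T x) (outerNormal T.1 F) = 0) :
    domainIntegral (M := M) (fun T x => divergence (fun y => a T y • w T y) x) =
      interfaceIntegral M (fun F x =>
        jumpV w F x * avg a F x + inner ℝ (jump a F x) (avg w F x)) := by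
  rw [domainIntegral_divergence (fun T y => a T y • w T y) fun T => (ha T).smul (hw T),
    interfaceIntegral, ← Finset.sum_subset
      (fun F => mem_facets_of_mem_interfaces (M := M)) fun F hF hFi => ?_]
  · exact Finset.sum_congr rfl fun F hF =>
      faceIntegral_congr fun x _ => sum_inner_smul_outerNormal hF a w x
  · have hFb := mem_boundaryFaces_of_notMem_interfaces hF hFi
    rw [faceIntegral_congr (h := fun _ => 0) fun x hx => Finset.sum_eq_zero fun T hT => by
      rw [real_inner_smul_left, hbdry F hFb T hT x hx, mul_zero]]
    exact integral_zero _ _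

end Skeleton

/-! ### Curves of functions -/

section UniformlyLipschitz

open Filter Topology

variable {X E F : Type*} [SeminormedAddCommGroup E] [SeminormedAddCommGroup F]

/-- Lipschitz continuity of a curve of functions at the time `t`, uniformly over the points of the
set `K`. It supplies the dominating functions when integrals over `K` are differentiated in time. -/
def UniformlyLipschitzAt (q : ℝ → X → E) (t : ℝ) (K : Set X) : Prop :=
  ∃ C : ℝ, ∀ᶠ s in 𝓝 t, ∀ x ∈ K, ‖q s x - q t x‖ ≤ C * |s - t|

theorem uniformlyLipschitzAt_const (g : X → E) (t : ℝ) (K : Set X) :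
    UniformlyLipschitzAt (fun _ => g) t K :=
  ⟨0, .of_forall fun s x _ => by rw [sub_self, norm_zero, zero_mul]⟩

theorem UniformlyLipschitzAt.prodMk {q : ℝ → X → E} {r : ℝ → X → F} {t : ℝ} {K : Set X}
    (hq : UniformlyLipschitzAt q t K) (hr : UniformlyLipschitzAt r t K) :
    UniformlyLipschitzAt (fun s x => (q s x, r s x)) t K := by
  obtain ⟨C, hC⟩ := hq
  obtain ⟨C', hC'⟩ := hr
  refine ⟨max C C', ?_⟩
  filter_upwards [hC, hC'] with s hs hs' x hx
  rw [max_mul_of_nonneg _ _ (abs_nonneg _)]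
  exact max_le_max (hs x hx) (hs' x hx)

end UniformlyLipschitz

section Curves

open Filter Topology

variable {X E : Type*} [NormedAddCommGroup E] [NormedSpace ℝ E]

/-- The curve can be expanded in a basis of `W`; the coordinates are differentiable because the
evaluation functionals span the dual of `W`. -/
theorem exists_eventually_eq_sum_smul (W : Submodule ℝ (X → E)) [FiniteDimensional ℝ W]
    {u : ℝ → X → E} {t : ℝ} (hW : ∀ᶠ s in 𝓝 t, u s ∈ W)
    (hu : ∀ x, DifferentiableAt ℝ (fun s => u s x) t) :
    ∃ (n : ℕ) (b : Fin n → X → E) (c : Fin n → ℝ → ℝ), (∀ j, b j ∈ W) ∧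
      (∀ j, DifferentiableAt ℝ (c j) t) ∧ ∀ᶠ s in 𝓝 t, u s = ∑ j, c j s • b j := by
  classical
  let ev : X × StrongDual ℝ E → W →ₗ[ℝ] ℝ := fun i =>
    i.2.toLinearMap ∘ₗ LinearMap.proj i.1 ∘ₗ W.subtype
  let p : ℝ → W := fun s => if hs : u s ∈ W then ⟨u s, hs⟩ else 0
  have hp : ∀ᶠ s in 𝓝 t, (p s : X → E) = u s := by
    filter_upwards [hW] with s hs
    simp only [p, dif_pos hs]
  have hdual : ∀ f : W →ₗ[ℝ] ℝ, DifferentiableAt ℝ (fun s => f (p s)) t := by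
    intro f
    have hf : f ∈ Submodule.span ℝ (range ev) := by
      refine FiniteDimensional.mem_span_of_iInf_ker_le_ker fun w hw => ?_
      have hw0 : w = 0 := Subtype.ext <| funext fun x =>
        SeparatingDual.eq_zero_of_forall_dual_eq_zero (R := ℝ) fun g =>
          (Submodule.mem_iInf _).1 hw (x, g)
      rw [hw0]
      exact Submodule.zero_mem _
    induction hf using Submodule.span_induction with
    | mem f h =>
      obtain ⟨⟨x, g⟩, rfl⟩ := h
      refine (g.differentiableAt.comp t (hu x)).congr_of_eventuallyEq ?_
      filter_upwards [hp] with s hs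
      simp only [ev, LinearMap.comp_apply, Submodule.subtype_apply, hs]
      rfl
    | zero => exact differentiableAt_const 0
    | add f g _ _ hf hg => exact hf.add hg
    | smul c f _ hf => exact hf.const_smul c
  let B := Module.finBasis ℝ W
  refine ⟨_, fun j => B j, fun j s => B.coord j (p s), fun j => (B j).2,
    fun j => hdual (B.coord j), ?_⟩
  filter_upwards [hp] with s hs
  rw [← hs]
  conv_lhs => rw [← B.sum_repr (p s), Submodule.coe_sum]
  rfl

theorem deriv_mem_of_eventually_mem (W : Submodule ℝ (X → E)) [FiniteDimensional ℝ W]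
    {u : ℝ → X → E} {t : ℝ} (hW : ∀ᶠ s in 𝓝 t, u s ∈ W)
    (hu : ∀ x, DifferentiableAt ℝ (fun s => u s x) t) :
    (fun x => deriv (fun s => u s x) t) ∈ W := by
  obtain ⟨n, b, c, hb, hc, hsum⟩ := exists_eventually_eq_sum_smul W hW hu
  have hderiv : (fun x => deriv (fun s => u s x) t) = ∑ j, deriv (c j) t • b j := by
    funext x
    have hx : HasDerivAt (fun s => ∑ j, c j s • b j x) (∑ j, deriv (c j) t • b j x) t :=
      HasDerivAt.fun_sum fun j _ => (hc j).hasDerivAt.smul_const (b j x)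
    simp only [Finset.sum_apply, Pi.smul_apply]
    refine (hx.congr_of_eventuallyEq ?_).deriv
    filter_upwards [hsum] with s hs
    simp only [hs, Finset.sum_apply, Pi.smul_apply]
  rw [hderiv]
  exact W.sum_mem fun j _ => W.smul_mem _ (hb j)

variable [TopologicalSpace X]

theorem uniformlyLipschitzAt_of_eventually_mem (W : Submodule ℝ (X → E)) [FiniteDimensional ℝ W]
    (hWc : ∀ w ∈ W, Continuous w) {u : ℝ → X → E} {t : ℝ} (hW : ∀ᶠ s in 𝓝 t, u s ∈ W)
    (hu : ∀ x, DifferentiableAt ℝ (fun s => u s x) t) {K : Set X} (hK : IsCompact K) :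
    UniformlyLipschitzAt u t K := by
  obtain ⟨n, b, c, hb, hc, hsum⟩ := exists_eventually_eq_sum_smul W hW hu
  choose R hR using fun j => hK.exists_bound_of_continuousOn (hWc _ (hb j)).continuousOn
  choose C hC using fun j => (hc j).hasDerivAt.isBigO_sub.bound
  refine ⟨∑ j, |C j| * |R j|, ?_⟩
  filter_upwards [hsum, eventually_all.2 hC] with s hs hCs x hx
  rw [hs, hsum.self_of_nhds, Finset.sum_apply, Finset.sum_apply, ← Finset.sum_sub_distrib,
    Finset.sum_mul]
  refine norm_sum_le_of_le _ fun j _ => ?_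
  calc ‖(c j s • b j) x - (c j t • b j) x‖ = ‖c j s - c j t‖ * ‖b j x‖ := by
        rw [Pi.smul_apply, Pi.smul_apply, ← sub_smul, norm_smul]
    _ ≤ (|C j| * |s - t|) * |R j| := by
        gcongr
        · exact (hCs j).trans (by rw [Real.norm_eq_abs]; gcongr; exact le_abs_self _)
        · exact (hR j x hx).trans (le_abs_self _)
    _ = |C j| * |R j| * |s - t| := by ring

end Curves

section DifferentiationUnderIntegral

open Filter Topology

theorem exists_dist_le_of_locallyLipschitzOn {A B : Type*} [PseudoMetricSpace A]
    [PseudoMetricSpace B] {G : A → B} {S Q : Set A} (hG : LocallyLipschitzOn S G)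
    (hQ : IsCompact Q) (hQS : Q ⊆ S) :
    ∃ L : NNReal, ∃ δ > 0, ∀ a ∈ Q, ∀ b ∈ S, dist b a < δ → dist (G b) (G a) ≤ L * dist b a := by
  suffices ∃ L : NNReal, ∃ δ > 0, ∀ a ∈ Q, a ∈ S → ∀ b ∈ S, dist b a < δ →
      dist (G b) (G a) ≤ L * dist b a by
    obtain ⟨L, δ, hδ, h⟩ := this
    exact ⟨L, δ, hδ, fun a ha => h a ha (hQS ha)⟩
  refine hQ.induction_on (p := fun Q => ∃ L : NNReal, ∃ δ > 0, ∀ a ∈ Q, a ∈ S → ∀ b ∈ S,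
    dist b a < δ → dist (G b) (G a) ≤ L * dist b a) ⟨0, 1, one_pos, fun a ha => ha.elim⟩ ?_ ?_ ?_
  · rintro Q₁ Q₂ hsub ⟨L, δ, hδ, h⟩
    exact ⟨L, δ, hδ, fun a ha => h a (hsub ha)⟩
  · rintro Q₁ Q₂ ⟨L₁, δ₁, hδ₁, h₁⟩ ⟨L₂, δ₂, hδ₂, h₂⟩
    refine ⟨max L₁ L₂, min δ₁ δ₂, lt_min hδ₁ hδ₂, ?_⟩
    rintro a (ha | ha) haS b hb hab
    · exact (h₁ a ha haS b hb (hab.trans_le (min_le_left _ _))).trans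
        (by gcongr; exact le_max_left _ _)
    · exact (h₂ a ha haS b hb (hab.trans_le (min_le_right _ _))).trans
        (by gcongr; exact le_max_right _ _)
  · intro x hx
    obtain ⟨L, N, hN, hL⟩ := hG (hQS hx)
    obtain ⟨ε, hε, hball⟩ := Metric.mem_nhdsWithin_iff.1 hN
    refine ⟨_, mem_nhdsWithin_of_mem_nhds (Metric.ball_mem_nhds x (half_pos hε)), L, ε / 2,
      half_pos hε, fun a ha haS b hb hab => ?_⟩
    have hax : dist a x < ε / 2 := ha
    exact hL.dist_le_mul b (hball ⟨(dist_triangle b a x).trans_lt (by linarith), hb⟩)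
      a (hball ⟨hax.trans (half_lt_self hε), haS⟩)

theorem locallyLipschitzOn_of_contDiffOn {A B : Type*} [NormedAddCommGroup A] [NormedSpace ℝ A]
    [NormedAddCommGroup B] [NormedSpace ℝ B] {G : A → B} {S : Set A} (hG : ContDiffOn ℝ 1 G S)
    (hS : Convex ℝ S) : LocallyLipschitzOn S G :=
  fun _ hx => (hG _ hx).exists_lipschitzOnWith hS

/-- A locally Lipschitz function is Lipschitz near the compact set `q t '' K`, which provides a
dominating function for the difference quotients. -/
theorem hasDerivAt_setIntegral_comp {X E : Type*} [TopologicalSpace X] [T2Space X]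
    [MeasurableSpace X] [OpensMeasurableSpace X] [SeminormedAddCommGroup E] {ν : Measure X}
    {K : Set X} (hK : IsCompact K) (hνK : ν K ≠ ⊤) {G : E → ℝ} {S : Set E}
    (hG : LocallyLipschitzOn S G) {q : ℝ → X → E} {t : ℝ}
    (hqS : ∀ᶠ s in 𝓝 t, ∀ x ∈ K, q s x ∈ S) (hqc : ∀ᶠ s in 𝓝 t, ContinuousOn (q s) K)
    (hq : UniformlyLipschitzAt q t K) {g' : X → ℝ} (hg' : ContinuousOn g' K)
    (hd : ∀ x ∈ K, HasDerivAt (fun s => G (q s x)) (g' x) t) :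
    HasDerivAt (fun s => ∫ x in K, G (q s x) ∂ν) (∫ x in K, g' x ∂ν) t := by
  obtain ⟨L, δ, hδ, hL⟩ := exists_dist_le_of_locallyLipschitzOn hG
    (hK.image_of_continuousOn hqc.self_of_nhds) (image_subset_iff.2 hqS.self_of_nhds)
  obtain ⟨C, hC⟩ := hq
  have hsmall : ∀ᶠ s in 𝓝 t, C * |s - t| < δ := by
    have hcont : ContinuousAt (fun s => C * |s - t|) t := by fun_prop
    exact hcont.eventually_lt_const (by simpa only [sub_self, abs_zero, mul_zero] using hδ)
  have hcont : ∀ᶠ s in 𝓝 t, ContinuousOn (fun x => G (q s x)) K := by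
    filter_upwards [hqS, hqc] with s hs hsc
    exact hG.continuousOn.comp hsc hs
  have : IsFiniteMeasure (ν.restrict K) := isFiniteMeasure_restrict.2 hνK
  have hint : ∀ {g : X → ℝ}, ContinuousOn g K → IntegrableOn g K ν := fun hg => by
    obtain ⟨R, hR⟩ := hK.exists_bound_of_continuousOn hg
    exact .of_bound hνK.lt_top (hg.aestronglyMeasurable hK.measurableSet) R
      (ae_restrict_of_forall_mem hK.measurableSet hR)
  let toMap : ℝ →L[ℝ] ℝ →L[ℝ] ℝ :=
    (ContinuousLinearMap.toSpanSingletonCLE (𝕜 := ℝ) (E := ℝ)).toContinuousLinearMap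
  have hderiv := (hasFDerivAt_integral_of_dominated_loc_of_lip' (𝕜 := ℝ) (μ := ν.restrict K)
    (F' := fun x => toMap (g' x)) (bound := fun _ => L * C) ((hqS.and hC).and (hsmall.and hcont))
    (fun s hs => hs.2.2.aestronglyMeasurable hK.measurableSet) (hint hcont.self_of_nhds)
    (toMap.integrable_comp (hint hg')).aestronglyMeasurable
    (ae_restrict_of_forall_mem hK.measurableSet fun x hx s hs => ?_) (integrable_const _)
    (ae_restrict_of_forall_mem hK.measurableSet fun x hx => (hd x hx).hasFDerivAt)).2
  · rw [toMap.integral_comp_comm (hint hg')] at hderiv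
    exact hasDerivAt_iff_hasFDerivAt.2 hderiv
  · have hqx : dist (q s x) (q t x) ≤ C * |s - t| := by simpa only [dist_eq_norm] using hs.1.2 x hx
    calc ‖G (q s x) - G (q t x)‖ ≤ L * dist (q s x) (q t x) := by
          rw [← dist_eq_norm]
          exact hL _ (mem_image_of_mem _ hx) _ (hs.1.1 x hx) (hqx.trans_lt hs.2.1)
      _ ≤ L * C * ‖s - t‖ := by
          rw [Real.norm_eq_abs, mul_assoc]
          gcongr

theorem hasDerivAt_setIntegral_bilin {X E F : Type*} [TopologicalSpace X] [T2Space X]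
    [MeasurableSpace X] [OpensMeasurableSpace X] [NormedAddCommGroup E] [NormedSpace ℝ E]
    [NormedAddCommGroup F] [NormedSpace ℝ F] {ν : Measure X} {K : Set X} (hK : IsCompact K)
    (hνK : ν K ≠ ⊤) (B : E →L[ℝ] F →L[ℝ] ℝ) (W : Submodule ℝ (X → E)) [FiniteDimensional ℝ W]
    (hWc : ∀ w ∈ W, Continuous w) {u : ℝ → X → E} {t : ℝ} (hW : ∀ᶠ s in 𝓝 t, u s ∈ W)
    (hu : ∀ x, DifferentiableAt ℝ (fun s => u s x) t) {g : X → F} (hg : ContinuousOn g K) :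
    HasDerivAt (fun s => ∫ x in K, B (u s x) (g x) ∂ν)
      (∫ x in K, B (deriv (fun s => u s x) t) (g x) ∂ν) t := by
  have hB : ContDiff ℝ 1 fun p : E × F => B p.1 p.2 := B.isBoundedBilinearMap.contDiff
  refine hasDerivAt_setIntegral_comp hK hνK (G := fun p : E × F => B p.1 p.2)
    (q := fun s x => (u s x, g x)) (locallyLipschitzOn_of_contDiffOn hB.contDiffOn convex_univ)
    (.of_forall fun _ _ _ => mem_univ _) ?_
    ((uniformlyLipschitzAt_of_eventually_mem W hWc hW hu hK).prodMk
      (uniformlyLipschitzAt_const g t K)) ?_ fun x _ => ?_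
  · filter_upwards [hW] with s hs using (hWc _ hs).continuousOn.prodMk hg
  · exact hB.continuous.comp_continuousOn
      ((hWc _ (deriv_mem_of_eventually_mem W hW hu)).continuousOn.prodMk hg)
  · exact (B.flip (g x)).hasFDerivAt.comp_hasDerivAt t (hu x).hasDerivAt

end DifferentiationUnderIntegral

/-! ### The discrete spaces -/

section Polynomials

variable (d k : ℕ)

/-- The space of polynomial functions of total degree at most `k`. -/
def polynomialsLE : Submodule ℝ (Vec d → ℝ) where
  carrier := {g | IsPolyLE k g}
  zero_mem' := ⟨0, by simp, by simp⟩
  add_mem' := by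
    rintro a b ⟨p, hp, hpe⟩ ⟨q, hq, hqe⟩
    exact ⟨p + q, (MvPolynomial.totalDegree_add p q).trans (max_le hp hq), fun x => by
      rw [Pi.add_apply, hpe, hqe, map_add]⟩
  smul_mem' := by
    rintro c a ⟨p, hp, hpe⟩
    exact ⟨c • p, (MvPolynomial.totalDegree_smul_le c p).trans hp, fun x => by
      rw [Pi.smul_apply, hpe, MvPolynomial.smul_eval, smul_eq_mul]⟩

/-- The space of vector fields whose components are polynomials of total degree at most `k`. -/
def polynomialFieldsLE : Submodule ℝ (Vec d → Vec d) where
  carrier := {w | ∀ i, (fun x => w x i) ∈ polynomialsLE d k}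
  zero_mem' _ := (polynomialsLE d k).zero_mem
  add_mem' ha hb i := (polynomialsLE d k).add_mem (ha i) (hb i)
  smul_mem' c _ ha i := (polynomialsLE d k).smul_mem c (ha i)

instance : FiniteDimensional ℝ (polynomialsLE d k) := by
  let l : MvPolynomial.restrictTotalDegree (Fin d) ℝ k →ₗ[ℝ] polynomialsLE d k :=
    { toFun := fun p => ⟨fun x => MvPolynomial.eval (⇑x) p.1,
        p.1, (MvPolynomial.mem_restrictTotalDegree _ _ _).1 p.2, fun _ => rfl⟩
      map_add' := fun p q => by ext x; exact map_add (MvPolynomial.eval (⇑x)) p.1 q.1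
      map_smul' := fun c p => by ext x; exact MvPolynomial.smul_eval (⇑x) p.1 c }
  refine Module.Finite.of_surjective l ?_
  rintro ⟨g, p, hp, hpe⟩
  exact ⟨⟨p, (MvPolynomial.mem_restrictTotalDegree _ _ _).2 hp⟩,
    Subtype.ext (funext fun x => (hpe x).symm)⟩

instance : FiniteDimensional ℝ (polynomialFieldsLE d k) := by
  let l : polynomialFieldsLE d k →ₗ[ℝ] Fin d → polynomialsLE d k :=
    { toFun := fun w i => ⟨fun x => w.1 x i, w.2 i⟩
      map_add' := fun _ _ => rfl
      map_smul' := fun _ _ => rfl }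
  refine Module.Finite.of_injective l fun w w' h => ?_
  ext x i
  exact congrFun (congrArg Subtype.val (congrFun h i)) x

variable {d k} {n : WithTop ℕ∞}

theorem contDiff_of_mem_polynomialsLE {g : Vec d → ℝ} (hg : g ∈ polynomialsLE d k) :
    ContDiff ℝ n g := by
  obtain ⟨p, -, hp⟩ := hg
  have heval : g = fun x : Vec d => ∑ m ∈ p.support, p.coeff m * ∏ i, x i ^ m i :=
    funext fun x => by rw [hp, MvPolynomial.eval_eq']
  rw [heval]
  fun_prop

theorem contDiff_of_mem_polynomialFieldsLE {w : Vec d → Vec d}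
    (hw : w ∈ polynomialFieldsLE d k) : ContDiff ℝ n w :=
  contDiff_euclidean.2 fun i => contDiff_of_mem_polynomialsLE (hw i)

end Polynomials

section DiscreteSpaces

open Filter Topology

variable {d : ℕ} {Ω : Set (Vec d)} {M : Triangulation d Ω} {k : ℕ}

theorem contDiff_of_mem_Vh {a : Broken M ℝ} (ha : a ∈ Vh M k) {n : WithTop ℕ∞} (T : M.Cell) :
    ContDiff ℝ n (a T) :=
  contDiff_of_mem_polynomialsLE (ha T)

theorem contDiff_of_mem_VhVec {w : Broken M (Vec d)} (hw : w ∈ VhVec M k) {n : WithTop ℕ∞}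
    (T : M.Cell) : ContDiff ℝ n (w T) :=
  contDiff_of_mem_polynomialFieldsLE fun i => hw i T

/-- The pointwise time derivative of a curve of broken functions. -/
def timeDeriv {E : Type} [NormedAddCommGroup E] [NormedSpace ℝ E] (u : ℝ → Broken M E) (t : ℝ) :
    Broken M E :=
  fun T x => deriv (fun s => u s T x) t

theorem timeDeriv_mem_Vh {u : ℝ → Broken M ℝ} {t : ℝ} (hmem : ∀ᶠ s in 𝓝 t, u s ∈ Vh M k)
    (hu : ∀ T x, DifferentiableAt ℝ (fun s => u s T x) t) : timeDeriv u t ∈ Vh M k := fun T =>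
  deriv_mem_of_eventually_mem (polynomialsLE d k) (u := fun s => u s T)
    (hmem.mono fun _ hs => hs T) (hu T)

theorem timeDeriv_mem_VhVec {w : ℝ → Broken M (Vec d)} {t : ℝ}
    (hmem : ∀ᶠ s in 𝓝 t, w s ∈ VhVec M k) (hw : ∀ T x, DifferentiableAt ℝ (fun s => w s T x) t) :
    timeDeriv w t ∈ VhVec M k := fun i T =>
  deriv_mem_of_eventually_mem (polynomialFieldsLE d k) (u := fun s => w s T)
    (hmem.mono fun _ hs j => hs j T) (hw T) i

theorem uniformlyLipschitzAt_of_mem_Vh {u : ℝ → Broken M ℝ} {t : ℝ}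
    (hmem : ∀ᶠ s in 𝓝 t, u s ∈ Vh M k) (hu : ∀ T x, DifferentiableAt ℝ (fun s => u s T x) t)
    (T : M.Cell) {K : Set (Vec d)} (hK : IsCompact K) :
    UniformlyLipschitzAt (fun s => u s T) t K :=
  uniformlyLipschitzAt_of_eventually_mem (polynomialsLE d k)
    (fun _ hw => (contDiff_of_mem_polynomialsLE (n := 0) hw).continuous)
    (hmem.mono fun _ hs => hs T) (hu T) hK

theorem uniformlyLipschitzAt_of_mem_VhVec {w : ℝ → Broken M (Vec d)} {t : ℝ}
    (hmem : ∀ᶠ s in 𝓝 t, w s ∈ VhVec M k) (hw : ∀ T x, DifferentiableAt ℝ (fun s => w s T x) t)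
    (T : M.Cell) {K : Set (Vec d)} (hK : IsCompact K) :
    UniformlyLipschitzAt (fun s => w s T) t K :=
  uniformlyLipschitzAt_of_eventually_mem (polynomialFieldsLE d k)
    (fun _ hw => (contDiff_of_mem_polynomialFieldsLE (n := 0) hw).continuous)
    (hmem.mono fun _ hs i => hs i T) (hw T) hK

end DiscreteSpaces

/-! ### The free energy along curves of states -/

namespace Model

variable (D : Model)

/-- The set of the values `(ρ, φ)` for which the free energy is given. -/
def region : Set (ℝ × ℝ) := Ioi 0 ×ˢ Icc 0 1

theorem convex_region : Convex ℝ region := (convex_Ioi 0).prod (convex_Icc 0 1)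

theorem uniqueDiffOn_region : UniqueDiffOn ℝ region :=
  isOpen_Ioi.uniqueDiffOn.prod (uniqueDiffOn_Icc zero_lt_one)

theorem contDiffOn_mul_f : ContDiffOn ℝ 1 (fun p : ℝ × ℝ => p.1 * D.f p.1 p.2) region :=
  contDiff_fst.contDiffOn.mul D.f_contDiffOn

theorem hasFDerivWithinAt_mul_f {p : ℝ × ℝ} (hp : p ∈ region) :
    HasFDerivWithinAt (fun p : ℝ × ℝ => p.1 * D.f p.1 p.2)
      (fderivWithin ℝ (fun p : ℝ × ℝ => p.1 * D.f p.1 p.2) region p) region p :=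
  (D.contDiffOn_mul_f.differentiableOn one_ne_zero p hp).hasFDerivWithinAt

theorem dρ_eq_fderivWithin {p : ℝ × ℝ} (hp : p ∈ region) :
    D.dρ p.1 p.2 = fderivWithin ℝ (fun p : ℝ × ℝ => p.1 * D.f p.1 p.2) region p (1, 0) := by
  have hline : HasDerivWithinAt (fun r : ℝ => (r, p.2)) (1, 0) (Ioi 0) p.1 :=
    ((hasDerivAt_id p.1).prodMk (hasDerivAt_const p.1 p.2)).hasDerivWithinAt
  have hcomp := (D.hasFDerivWithinAt_mul_f hp).comp_hasDerivWithinAt (f := fun r => (r, p.2))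
    p.1 hline fun r hr => ⟨hr, hp.2⟩
  exact (hcomp.hasDerivAt (isOpen_Ioi.mem_nhds hp.1)).deriv

theorem dφ_eq_fderivWithin {p : ℝ × ℝ} (hp : p ∈ region) :
    D.dφ p.1 p.2 = fderivWithin ℝ (fun p : ℝ × ℝ => p.1 * D.f p.1 p.2) region p (0, 1) := by
  have hline : HasDerivWithinAt (fun s : ℝ => (p.1, s)) (0, 1) (Icc 0 1) p.2 :=
    ((hasDerivAt_const p.2 p.1).prodMk (hasDerivAt_id p.2)).hasDerivWithinAt
  have hcomp := (D.hasFDerivWithinAt_mul_f hp).comp_hasDerivWithinAt (f := fun s => (p.1, s))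
    p.2 hline fun s hs => ⟨hp.1, hs⟩
  exact hcomp.derivWithin (uniqueDiffOn_Icc zero_lt_one p.2 hp.2)

theorem continuousOn_fderivWithin_mul_f (e : ℝ × ℝ) :
    ContinuousOn (fun p => fderivWithin ℝ (fun p : ℝ × ℝ => p.1 * D.f p.1 p.2) region p e)
      region :=
  (D.contDiffOn_mul_f.continuousOn_fderivWithin uniqueDiffOn_region le_rfl).clm_apply
    continuousOn_const

theorem continuousOn_dρ : ContinuousOn (fun p : ℝ × ℝ => D.dρ p.1 p.2) region :=
  (D.continuousOn_fderivWithin_mul_f (1, 0)).congr fun _ hp => D.dρ_eq_fderivWithin hp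

theorem continuousOn_dφ : ContinuousOn (fun p : ℝ × ℝ => D.dφ p.1 p.2) region :=
  (D.continuousOn_fderivWithin_mul_f (0, 1)).congr fun _ hp => D.dφ_eq_fderivWithin hp

theorem hasDerivAt_mul_f {r p : ℝ → ℝ} {r' p' t : ℝ} (hr : HasDerivAt r r' t)
    (hp : HasDerivAt p p' t) (hreg : ∀ᶠ s in nhds t, (r s, p s) ∈ region) :
    HasDerivAt (fun s => r s * D.f (r s) (p s))
      (D.dρ (r t) (p t) * r' + D.dφ (r t) (p t) * p') t := by
  have ht := hreg.self_of_nhds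
  have hcurve : HasDerivWithinAt (fun s => (r s, p s)) (r', p') {s | (r s, p s) ∈ region} t :=
    (hr.prodMk hp).hasDerivWithinAt
  have hcomp := ((D.hasFDerivWithinAt_mul_f ht).comp_hasDerivWithinAt
    (f := fun s => (r s, p s)) t hcurve fun s hs => hs).hasDerivAt hreg
  refine hcomp.congr_deriv ?_
  have hsplit : (r', p') = r' • ((1 : ℝ), (0 : ℝ)) + p' • ((0 : ℝ), (1 : ℝ)) := by simp
  rw [D.dρ_eq_fderivWithin ht, D.dφ_eq_fderivWithin ht, hsplit, map_add, map_smul, map_smul,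
    smul_eq_mul, smul_eq_mul, mul_comm r', mul_comm p']

variable {d : ℕ}

/-- The energy density as a function of `((ρ, φ), (σ, v))`. -/
def energyDensity (p : (ℝ × ℝ) × (Vec d × Vec d)) : ℝ :=
  p.1.1 * D.f p.1.1 p.1.2 + D.γ / 2 * ‖p.2.1‖ ^ 2 + p.1.1 / 2 * ‖p.2.2‖ ^ 2

theorem contDiffOn_energyDensity :
    ContDiffOn ℝ 1 (D.energyDensity (d := d)) (region ×ˢ univ) := by
  have hfree : ContDiffOn ℝ 1 (fun p : (ℝ × ℝ) × (Vec d × Vec d) => p.1.1 * D.f p.1.1 p.1.2)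
      (region ×ˢ univ) :=
    D.contDiffOn_mul_f.comp contDiff_fst.contDiffOn fun p hp => hp.1
  have hgradient : ContDiff ℝ 1 fun p : (ℝ × ℝ) × (Vec d × Vec d) => D.γ / 2 * ‖p.2.1‖ ^ 2 :=
    contDiff_const.mul ((contDiff_fst.comp contDiff_snd).norm_sq ℝ)
  have hkinetic : ContDiff ℝ 1 fun p : (ℝ × ℝ) × (Vec d × Vec d) =>
      p.1.1 / 2 * ‖p.2.2‖ ^ 2 :=
    ((contDiff_fst.comp contDiff_fst).div_const 2).mul ((contDiff_snd.comp contDiff_snd).norm_sq ℝ)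
  exact (hfree.add hgradient.contDiffOn).add hkinetic.contDiffOn

theorem locallyLipschitzOn_energyDensity :
    LocallyLipschitzOn (region ×ˢ univ) (D.energyDensity (d := d)) :=
  locallyLipschitzOn_of_contDiffOn D.contDiffOn_energyDensity (convex_region.prod convex_univ)

theorem hasDerivAt_energyDensity {r p : ℝ → ℝ} {a v : ℝ → Vec d} {r' p' t : ℝ} {a' v' : Vec d}
    (hr : HasDerivAt r r' t) (hp : HasDerivAt p p' t) (ha : HasDerivAt a a' t)
    (hv : HasDerivAt v v' t) (hreg : ∀ᶠ s in nhds t, (r s, p s) ∈ region) :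
    HasDerivAt (fun s => D.energyDensity ((r s, p s), (a s, v s)))
      (D.dρ (r t) (p t) * r' + D.dφ (r t) (p t) * p' + D.γ * inner ℝ a' (a t)
        + 1 / 2 * ‖v t‖ ^ 2 * r' + r t * inner ℝ v' (v t)) t := by
  refine (((D.hasDerivAt_mul_f hr hp hreg).add (ha.norm_sq.const_mul (D.γ / 2))).add
    ((hr.div_const 2).mul hv.norm_sq)).congr_deriv ?_
  rw [real_inner_comm (a t), real_inner_comm (v t)]
  ring

end Model

/-! ### Differential identities -/

section DifferentialOperators

variable {d : ℕ}

theorem continuous_gradient {g : Vec d → ℝ} (hg : ContDiff ℝ 1 g) : Continuous (∇ g) :=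
  (InnerProductSpace.toDual ℝ (Vec d)).symm.continuous.comp (hg.continuous_fderiv one_ne_zero)

theorem continuous_divergence {w : Vec d → Vec d} (hw : ContDiff ℝ 1 w) :
    Continuous (divergence w) := by
  change Continuous fun x => ∑ i, fderiv ℝ w x (EuclideanSpace.single i 1) i
  exact continuous_finsetSum _ fun i _ => (EuclideanSpace.proj i : Vec d →L[ℝ] ℝ).continuous.comp
    ((hw.continuous_fderiv one_ne_zero).clm_apply continuous_const)

theorem continuous_divConvection {ρ : Vec d → ℝ} {v : Vec d → Vec d} (hρ : ContDiff ℝ 1 ρ)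
    (hv : ContDiff ℝ 1 v) : Continuous (divConvection ρ v) :=
  (PiLp.continuous_toLp 2 _).comp <| continuous_pi fun i =>
    continuous_divergence ((hρ.mul (contDiff_euclidean.1 hv i)).smul hv)

theorem divergence_smul {a : Vec d → ℝ} {w : Vec d → Vec d} {x : Vec d}
    (ha : DifferentiableAt ℝ a x) (hw : DifferentiableAt ℝ w x) :
    divergence (fun y => a y • w y) x = a x * divergence w x + inner ℝ (∇ a x) (w x) := by
  have hfderiv : fderiv ℝ (fun y => a y • w y) x =
      a x • fderiv ℝ w x + (fderiv ℝ a x).smulRight (w x) := fderiv_fun_smul ha hw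
  have hbasis : w x = ∑ i, w x i • EuclideanSpace.single i (1 : ℝ) := by
    ext j
    simp [Pi.single_apply]
  have hinner : inner ℝ (∇ a x) (w x) =
      ∑ i, fderiv ℝ a x (EuclideanSpace.single i 1) * w x i := by
    rw [inner_gradient_left]
    conv_lhs => rw [hbasis, map_sum]
    exact Finset.sum_congr rfl fun i _ => by rw [map_smul, smul_eq_mul, mul_comm]
  rw [hinner]
  simp only [divergence, Matrix.trace, Matrix.diag, jacobian, Matrix.of_apply, hfderiv,
    Finset.mul_sum, ← Finset.sum_add_distrib]
  rfl

/-- The kinetic energy is transported by the momentum density. -/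
theorem inner_divConvection {ρ : Vec d → ℝ} {v : Vec d → Vec d} {x : Vec d}
    (hρ : DifferentiableAt ℝ ρ x) (hv : DifferentiableAt ℝ v x) :
    inner ℝ (divConvection ρ v x) (v x) =
      divergence (fun y => ρ y • v y) x * ‖v x‖ ^ 2 +
        1 / 2 * ρ x * inner ℝ (∇ (fun y => ‖v y‖ ^ 2) x) (v x) := by
  have hcomponent : ∀ i, divConvection ρ v x i =
      v x i * divergence (fun y => ρ y • v y) x + ρ x * (fderiv ℝ v x (v x)) i := by
    intro i
    have hvi : HasFDerivAt (fun y => v y i)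
        ((EuclideanSpace.proj i : Vec d →L[ℝ] ℝ).comp (fderiv ℝ v x)) x :=
      (EuclideanSpace.proj i : Vec d →L[ℝ] ℝ).hasFDerivAt.comp x hv.hasFDerivAt
    have hcomm : (fun y => (ρ y * v y i) • v y) = fun y => v y i • (ρ y • v y) := by
      ext1 y
      rw [smul_smul, mul_comm]
    change divergence (fun y => (ρ y * v y i) • v y) x = _
    rw [hcomm, divergence_smul hvi.differentiableAt (hρ.fun_smul hv), inner_gradient_left,
      hvi.fderiv, ContinuousLinearMap.comp_apply, map_smul, map_smul, smul_eq_mul]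
    rfl
  have hgradient : inner ℝ (∇ (fun y => ‖v y‖ ^ 2) x) (v x) =
      2 * inner ℝ (v x) (fderiv ℝ v x (v x)) := by
    rw [inner_gradient_left, hv.hasFDerivAt.norm_sq.fderiv]
    simp
  rw [hgradient, EuclideanSpace.real_norm_sq_eq, PiLp.inner_apply, PiLp.inner_apply]
  simp only [hcomponent, RCLike.inner_apply, conj_trivial]
  rw [Finset.mul_sum, Finset.mul_sum, Finset.mul_sum, ← Finset.sum_add_distrib]
  exact Finset.sum_congr rfl fun i _ => by ring

/-- Tested with the velocity, the convective terms of the momentum balance cancel. -/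
theorem inner_momentum_density {ρ : Vec d → ℝ} {v : Vec d → Vec d} {x : Vec d}
    (hρ : DifferentiableAt ℝ ρ x) (hv : DifferentiableAt ℝ v x) (a b c : Vec d) :
    inner ℝ (a + divConvection ρ v x - divergence (fun y => ρ y • v y) x • v x + b - c
        - (1 / 2 * ρ x) • ∇ (fun y => ‖v y‖ ^ 2) x) (v x) =
      inner ℝ a (v x) + inner ℝ b (v x) - inner ℝ c (v x) := by
  rw [inner_sub_left, inner_sub_left, inner_add_left, inner_sub_left, inner_add_left,
    inner_divConvection hρ hv, real_inner_smul_left, real_inner_smul_left,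
    real_inner_self_eq_norm_sq]
  ring

end DifferentialOperators

/-! ### Integrals of broken functions -/

section BrokenIntegrals

variable {d : ℕ} {Ω : Set (Vec d)} {M : Triangulation d Ω}

/-- Continuity on every closed cell, which makes the integrals over the cells converge. -/
def CellContinuous (g : Broken M ℝ) : Prop :=
  ∀ T, ContinuousOn (g T) (convexHull ℝ (T.1 : Set (Vec d)))

theorem CellContinuous.integrableOn {g : Broken M ℝ} (hg : CellContinuous g) (T : M.Cell) :
    IntegrableOn (g T) (convexHull ℝ (T.1 : Set (Vec d))) :=
  (hg T).integrableOn_compact (isCompact_convexHull_finset T.1)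

theorem domainIntegral_add {g h : Broken M ℝ} (hg : CellContinuous g) (hh : CellContinuous h) :
    domainIntegral (fun T x => g T x + h T x) = domainIntegral g + domainIntegral h := by
  simp only [domainIntegral, ← Finset.sum_add_distrib]
  exact Finset.sum_congr rfl fun T _ => integral_add (hg.integrableOn T) (hh.integrableOn T)

theorem domainIntegral_const_mul (c : ℝ) (g : Broken M ℝ) :
    domainIntegral (fun T x => c * g T x) = c * domainIntegral g := by
  simp only [domainIntegral, Finset.mul_sum]
  exact Finset.sum_congr rfl fun T _ => integral_const_mul c _

theorem domainIntegral_nonneg {g : Broken M ℝ}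
    (hg : ∀ T : M.Cell, ∀ x ∈ convexHull ℝ (T.1 : Set (Vec d)), 0 ≤ g T x) :
    0 ≤ domainIntegral g :=
  Finset.sum_nonneg fun T _ =>
    setIntegral_nonneg (isCompact_convexHull_finset T.1).measurableSet (hg T)

theorem faceIntegral_nonneg {F : Finset (Vec d)} {g : Vec d → ℝ} (hg : ∀ x, 0 ≤ g x) :
    0 ≤ faceIntegral F g :=
  integral_nonneg hg

theorem interfaceIntegral_nonneg {G : Finset (Vec d) → Vec d → ℝ} (hG : ∀ F x, 0 ≤ G F x) :
    0 ≤ interfaceIntegral M G :=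
  Finset.sum_nonneg fun F _ => faceIntegral_nonneg (hG F)

theorem interfaceIntegral_add {G H : Finset (Vec d) → Vec d → ℝ}
    (hG : ∀ F, Continuous (G F)) (hH : ∀ F, Continuous (H F)) :
    interfaceIntegral M (fun F x => G F x + H F x) =
      interfaceIntegral M G + interfaceIntegral M H := by
  simp only [interfaceIntegral, ← Finset.sum_add_distrib]
  exact Finset.sum_congr rfl fun F hF =>
    faceIntegral_add (card_of_mem_facets (mem_facets_of_mem_interfaces hF)) (hG F) (hH F)

theorem interfaceIntegral_const_mul (c : ℝ) (G : Finset (Vec d) → Vec d → ℝ) :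
    interfaceIntegral M (fun F x => c * G F x) = c * interfaceIntegral M G := by
  simp only [interfaceIntegral, Finset.mul_sum]
  exact Finset.sum_congr rfl fun F _ => faceIntegral_const_mul F c (G F)

theorem continuous_avg {V : Type} [NormedAddCommGroup V] [NormedSpace ℝ V] {u : Broken M V}
    (hu : ∀ T, Continuous (u T)) (F : Finset (Vec d)) : Continuous (avg u F) :=
  continuous_const.smul (continuous_finsetSum _ fun T _ => hu T)

theorem continuous_jump {u : Broken M ℝ} (hu : ∀ T, Continuous (u T)) (F : Finset (Vec d)) :
    Continuous (jump u F) :=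
  continuous_finsetSum _ fun T _ => (hu T).smul continuous_const

theorem continuous_jumpV {w : Broken M (Vec d)} (hw : ∀ T, Continuous (w T))
    (F : Finset (Vec d)) : Continuous (jumpV w F) :=
  continuous_finsetSum _ fun T _ => (hw T).inner continuous_const

theorem frob_self_nonneg (A : Matrix (Fin d) (Fin d) ℝ) : 0 ≤ frob A A :=
  Finset.sum_nonneg fun _ _ => Finset.sum_nonneg fun _ _ => mul_self_nonneg _

theorem dgNormSq_nonneg (w : Broken M (Vec d)) : 0 ≤ dgNormSq w := by
  have hface : ∀ F : Finset (Vec d),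
      0 ≤ faceIntegral F fun x => (faceArea F)⁻¹ * frob (jumpT w F x) (jumpT w F x) := fun F =>
    faceIntegral_nonneg fun x => mul_nonneg (inv_nonneg.2 ENNReal.toReal_nonneg)
      (frob_self_nonneg _)
  exact add_nonneg (domainIntegral_nonneg fun T x _ => frob_self_nonneg _)
    (add_nonneg (Finset.sum_nonneg fun F _ => hface F) (Finset.sum_nonneg fun F _ => hface F))

theorem Model.IsCoercivePenalty.Bh_nonneg {k : ℕ} {D : Model} {αB : ℝ}
    (hB : D.IsCoercivePenalty M k αB) {φ : Broken M ℝ} (hφ : φ ∈ Vh M k)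
    (hφ_mem : ∀ T : M.Cell, ∀ x ∈ convexHull ℝ (T.1 : Set (Vec d)), φ T x ∈ Icc (0 : ℝ) 1)
    {w : Broken M (Vec d)} (hw : w ∈ VhZero M k) : 0 ≤ D.Bh αB φ w w := by
  obtain ⟨c, hc, hcoercive⟩ := hB φ hφ hφ_mem
  exact (mul_nonneg hc.le (dgNormSq_nonneg w)).trans (hcoercive w hw)

end BrokenIntegrals

section TimeDerivatives

open Filter Topology

variable {d : ℕ} {Ω : Set (Vec d)} {M : Triangulation d Ω} {k : ℕ} {t : ℝ}

theorem hasDerivAt_domainIntegral_mul {u : ℝ → Broken M ℝ} (hmem : ∀ᶠ s in 𝓝 t, u s ∈ Vh M k)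
    (hu : ∀ T x, DifferentiableAt ℝ (fun s => u s T x) t) {g : Broken M ℝ}
    (hg : CellContinuous g) :
    HasDerivAt (fun s => domainIntegral fun T x => u s T x * g T x)
      (domainIntegral fun T x => timeDeriv u t T x * g T x) t :=
  HasDerivAt.fun_sum fun T _ => hasDerivAt_setIntegral_bilin (isCompact_convexHull_finset T.1)
    (isCompact_convexHull_finset T.1).measure_ne_top (ContinuousLinearMap.mul ℝ ℝ)
    (polynomialsLE d k) (fun _ hp => (contDiff_of_mem_polynomialsLE (n := 0) hp).continuous)
    (hmem.mono fun _ hs => hs T) (hu T) (hg T)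

theorem hasDerivAt_domainIntegral_inner {w : ℝ → Broken M (Vec d)}
    (hmem : ∀ᶠ s in 𝓝 t, w s ∈ VhVec M k) (hw : ∀ T x, DifferentiableAt ℝ (fun s => w s T x) t)
    {z : Broken M (Vec d)} (hz : ∀ T, Continuous (z T)) :
    HasDerivAt (fun s => domainIntegral fun T x => inner ℝ (w s T x) (z T x))
      (domainIntegral fun T x => inner ℝ (timeDeriv w t T x) (z T x)) t :=
  HasDerivAt.fun_sum fun T _ => hasDerivAt_setIntegral_bilin (isCompact_convexHull_finset T.1)
    (isCompact_convexHull_finset T.1).measure_ne_top (innerSL ℝ)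
    (polynomialFieldsLE d k)
    (fun _ hp => (contDiff_of_mem_polynomialFieldsLE (n := 0) hp).continuous)
    (hmem.mono fun _ hs i => hs i T) (hw T) (hz T).continuousOn

theorem avg_mem_polynomialsLE {a : Broken M ℝ} (ha : a ∈ Vh M k) (F : Finset (Vec d)) :
    avg a F ∈ polynomialsLE d k := by
  have havg : avg a F = ((M.cellsAt F).card : ℝ)⁻¹ • ∑ T ∈ M.cellsAt F, a T := by
    funext x
    rw [avg, Pi.smul_apply, Finset.sum_apply]
  rw [havg]
  exact Submodule.smul_mem _ _ (Submodule.sum_mem _ fun T _ => ha T)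

theorem hasDerivAt_avg {u : ℝ → Broken M ℝ}
    (hu : ∀ T x, DifferentiableAt ℝ (fun s => u s T x) t) (F : Finset (Vec d)) (x : Vec d) :
    HasDerivAt (fun s => avg (u s) F x) (avg (timeDeriv u t) F x) t :=
  (HasDerivAt.fun_sum fun T _ => (hu T x).hasDerivAt).fun_const_smul _

theorem hasDerivAt_interfaceIntegral_avg_mul {u : ℝ → Broken M ℝ}
    (hmem : ∀ᶠ s in 𝓝 t, u s ∈ Vh M k) (hu : ∀ T x, DifferentiableAt ℝ (fun s => u s T x) t)
    {G : Finset (Vec d) → Vec d → ℝ} (hG : ∀ F, Continuous (G F)) :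
    HasDerivAt (fun s => interfaceIntegral M fun F x => avg (u s) F x * G F x)
      (interfaceIntegral M fun F x => avg (timeDeriv u t) F x * G F x) t := by
  refine HasDerivAt.fun_sum fun F hF => ?_
  have hcard := card_of_mem_facets (mem_facets_of_mem_interfaces hF)
  have hderiv := hasDerivAt_setIntegral_bilin (isCompact_convexHull_finset F)
    (euclideanHausdorffMeasure_facet_lt_top hcard).ne (ContinuousLinearMap.mul ℝ ℝ)
    (polynomialsLE d k) (fun _ hp => (contDiff_of_mem_polynomialsLE (n := 0) hp).continuous)
    (hmem.mono fun _ hs => avg_mem_polynomialsLE hs F)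
    (fun x => (hasDerivAt_avg hu F x).differentiableAt) (hG F).continuousOn
  simp only [fun x => (hasDerivAt_avg hu F x).deriv] at hderiv
  exact hderiv

end TimeDerivatives

/-! ### The time derivative of the energy -/

section Energy

open Filter Topology

variable {d : ℕ} {Ω : Set (Vec d)} {M : Triangulation d Ω} {k : ℕ} {D : Model} {αB : ℝ}
  {Fl : Fluxes M} {t₁ : ℝ} {U : ℝ → State M} {t : ℝ}

/-- The density of the time derivative of the energy along the curve `U` of states, obtained by
the chain rule. -/
def energyRate (D : Model) (U : ℝ → State M) (t : ℝ) : Broken M ℝ := fun T x =>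
  D.dρ ((U t).ρ T x) ((U t).φ T x) * timeDeriv (fun s => (U s).ρ) t T x
    + D.dφ ((U t).ρ T x) ((U t).φ T x) * timeDeriv (fun s => (U s).φ) t T x
    + D.γ * inner ℝ (timeDeriv (fun s => (U s).σ) t T x) ((U t).σ T x)
    + 1 / 2 * ‖(U t).v T x‖ ^ 2 * timeDeriv (fun s => (U s).ρ) t T x
    + (U t).ρ T x * inner ℝ (timeDeriv (fun s => (U s).v) t T x) ((U t).v T x)

namespace IsSemiDiscrete

section Regularity

variable {n : WithTop ℕ∞} (hU : IsSemiDiscrete D k αB Fl t₁ U) (ht : t ∈ Icc 0 t₁) (T : M.Cell)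
include hU ht

theorem contDiff_ρ : ContDiff ℝ n ((U t).ρ T) := contDiff_of_mem_Vh (hU.mem t ht).1 T

theorem contDiff_v : ContDiff ℝ n ((U t).v T) := contDiff_of_mem_VhVec (hU.mem t ht).2.1.1 T

theorem contDiff_φ : ContDiff ℝ n ((U t).φ T) := contDiff_of_mem_Vh (hU.mem t ht).2.2.1 T

theorem contDiff_μ : ContDiff ℝ n ((U t).μ T) := contDiff_of_mem_Vh (hU.mem t ht).2.2.2.1 T

theorem contDiff_τ : ContDiff ℝ n ((U t).τ T) := contDiff_of_mem_Vh (hU.mem t ht).2.2.2.2.1 T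

theorem contDiff_σ : ContDiff ℝ n ((U t).σ T) :=
  contDiff_of_mem_VhVec (hU.mem t ht).2.2.2.2.2.1 T

theorem mem_region {x : Vec d} (hx : x ∈ convexHull ℝ (T.1 : Set (Vec d))) :
    ((U t).ρ T x, (U t).φ T x) ∈ Model.region :=
  ⟨hU.ρ_pos t ht T x hx, hU.φ_mem t ht T x hx⟩

theorem continuous_ρ_φ : Continuous fun x => ((U t).ρ T x, (U t).φ T x) :=
  (hU.contDiff_ρ (n := 0) ht T).continuous.prodMk (hU.contDiff_φ (n := 0) ht T).continuous

theorem continuousOn_dρ : ContinuousOn (fun x => D.dρ ((U t).ρ T x) ((U t).φ T x))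
    (convexHull ℝ (T.1 : Set (Vec d))) :=
  D.continuousOn_dρ.comp (hU.continuous_ρ_φ ht T).continuousOn fun _ => hU.mem_region ht T

theorem continuousOn_dφ : ContinuousOn (fun x => D.dφ ((U t).ρ T x) ((U t).φ T x))
    (convexHull ℝ (T.1 : Set (Vec d))) :=
  D.continuousOn_dφ.comp (hU.continuous_ρ_φ ht T).continuousOn fun _ => hU.mem_region ht T

end Regularity

variable (hU : IsSemiDiscrete D k αB Fl t₁ U) (ht : t ∈ Ioo 0 t₁)
include hU ht

theorem eventually_mem : ∀ᶠ s in 𝓝 t, U s ∈ StateSpace M k := by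
  filter_upwards [Icc_mem_nhds ht.1 ht.2] with s hs using hU.mem s hs

theorem differentiableAt_ρ (T : M.Cell) (x : Vec d) :
    DifferentiableAt ℝ (fun s => (U s).ρ T x) t :=
  (hU.diff_ρ T x).differentiableAt (Icc_mem_nhds ht.1 ht.2)

theorem differentiableAt_v (T : M.Cell) (x : Vec d) :
    DifferentiableAt ℝ (fun s => (U s).v T x) t :=
  (hU.diff_v T x).differentiableAt (Icc_mem_nhds ht.1 ht.2)

theorem differentiableAt_φ (T : M.Cell) (x : Vec d) :
    DifferentiableAt ℝ (fun s => (U s).φ T x) t :=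
  (hU.diff_φ T x).differentiableAt (Icc_mem_nhds ht.1 ht.2)

theorem differentiableAt_σ (T : M.Cell) (x : Vec d) :
    DifferentiableAt ℝ (fun s => (U s).σ T x) t :=
  (hU.diff_σ T x).differentiableAt (Icc_mem_nhds ht.1 ht.2)

theorem timeDeriv_ρ_mem : timeDeriv (fun s => (U s).ρ) t ∈ Vh M k :=
  timeDeriv_mem_Vh ((hU.eventually_mem ht).mono fun _ hs => hs.1) (hU.differentiableAt_ρ ht)

theorem timeDeriv_v_mem : timeDeriv (fun s => (U s).v) t ∈ VhVec M k :=
  timeDeriv_mem_VhVec ((hU.eventually_mem ht).mono fun _ hs => hs.2.1.1)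
    (hU.differentiableAt_v ht)

theorem timeDeriv_φ_mem : timeDeriv (fun s => (U s).φ) t ∈ Vh M k :=
  timeDeriv_mem_Vh ((hU.eventually_mem ht).mono fun _ hs => hs.2.2.1) (hU.differentiableAt_φ ht)

theorem timeDeriv_σ_mem : timeDeriv (fun s => (U s).σ) t ∈ VhVec M k :=
  timeDeriv_mem_VhVec ((hU.eventually_mem ht).mono fun _ hs => hs.2.2.2.2.2.1)
    (hU.differentiableAt_σ ht)

theorem uniformlyLipschitzAt (T : M.Cell) {K : Set (Vec d)} (hK : IsCompact K) :
    UniformlyLipschitzAt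
      (fun s x => (((U s).ρ T x, (U s).φ T x), ((U s).σ T x, (U s).v T x))) t K := by
  have hmem := hU.eventually_mem ht
  exact ((uniformlyLipschitzAt_of_mem_Vh (hmem.mono fun _ hs => hs.1)
      (hU.differentiableAt_ρ ht) T hK).prodMk
    (uniformlyLipschitzAt_of_mem_Vh (hmem.mono fun _ hs => hs.2.2.1)
      (hU.differentiableAt_φ ht) T hK)).prodMk
    ((uniformlyLipschitzAt_of_mem_VhVec (hmem.mono fun _ hs => hs.2.2.2.2.2.1)
      (hU.differentiableAt_σ ht) T hK).prodMk
    (uniformlyLipschitzAt_of_mem_VhVec (hmem.mono fun _ hs => hs.2.1.1)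
      (hU.differentiableAt_v ht) T hK))

theorem cellContinuous_energyRate : CellContinuous (energyRate D U t) := fun T => by
  have htI := Ioo_subset_Icc_self ht
  have hρ := (hU.contDiff_ρ (n := 0) htI T).continuous
  have hv := (hU.contDiff_v (n := 0) htI T).continuous
  have hσ := (hU.contDiff_σ (n := 0) htI T).continuous
  have hρ' := (contDiff_of_mem_Vh (hU.timeDeriv_ρ_mem ht) (n := 0) T).continuous
  have hφ' := (contDiff_of_mem_Vh (hU.timeDeriv_φ_mem ht) (n := 0) T).continuous
  have hv' := (contDiff_of_mem_VhVec (hU.timeDeriv_v_mem ht) (n := 0) T).continuous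
  have hσ' := (contDiff_of_mem_VhVec (hU.timeDeriv_σ_mem ht) (n := 0) T).continuous
  exact (((((hU.continuousOn_dρ htI T).mul hρ'.continuousOn).add
    ((hU.continuousOn_dφ htI T).mul hφ'.continuousOn)).add
    (continuous_const.mul (hσ'.inner hσ)).continuousOn).add
    ((continuous_const.mul (hv.norm.pow 2)).mul hρ').continuousOn).add
    (hρ.mul (hv'.inner hv)).continuousOn

theorem hasDerivAt_energy :
    HasDerivAt (fun s => D.energy (U s)) (domainIntegral (energyRate D U t)) t := by
  refine HasDerivAt.fun_sum fun T _ => ?_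
  have hK := isCompact_convexHull_finset T.1
  have hIcc : ∀ᶠ s in 𝓝 t, s ∈ Icc 0 t₁ := Icc_mem_nhds ht.1 ht.2
  refine hasDerivAt_setIntegral_comp hK hK.measure_ne_top D.locallyLipschitzOn_energyDensity
    (q := fun s x => (((U s).ρ T x, (U s).φ T x), ((U s).σ T x, (U s).v T x)))
    (hIcc.mono fun s hs x hx => ⟨hU.mem_region hs T hx, mem_univ _⟩)
    (hIcc.mono fun s hs => ?_) (hU.uniformlyLipschitzAt ht T hK)
    (hU.cellContinuous_energyRate ht T) fun x hx => ?_
  · exact ((hU.continuous_ρ_φ hs T).prodMk ((hU.contDiff_σ (n := 0) hs T).continuous.prodMk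
      (hU.contDiff_v (n := 0) hs T).continuous)).continuousOn
  · exact D.hasDerivAt_energyDensity (hU.differentiableAt_ρ ht T x).hasDerivAt
      (hU.differentiableAt_φ ht T x).hasDerivAt (hU.differentiableAt_σ ht T x).hasDerivAt
      (hU.differentiableAt_v ht T x).hasDerivAt (hIcc.mono fun s hs => hU.mem_region hs T hx)

end IsSemiDiscrete

end Energy

/-! ### Testing the scheme -/

section Dissipation

open Filter Topology

variable {d : ℕ} {Ω : Set (Vec d)} {M : Triangulation d Ω} {k : ℕ} {D : Model} {αB : ℝ}
  {α₁ α₂ α₃ : ℝ} {t₁ : ℝ} {U : ℝ → State M} {t : ℝ}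

/-- The jump terms produced by integrating `div (τ ρ v)` by parts cancel against the fluxes of the
mass and momentum balances, up to stabilization and a term compensated in the phase equation. -/
theorem interfaceIntegral_mass_add_momentum (D : Model) (α₁ α₂ α₃ : ℝ) {V : State M}
    (hρ : ∀ T, Continuous (V.ρ T)) (hv : ∀ T, Continuous (V.v T)) (hφ : ∀ T, Continuous (V.φ T))
    (hμ : ∀ T, Continuous (V.μ T)) (hτ : ∀ T, Continuous (V.τ T)) :
    interfaceIntegral M ((stabilizedFluxes M D α₁ α₂ α₃).F₁ V V.τ)
        + interfaceIntegral M ((stabilizedFluxes M D α₁ α₂ α₃).F₂ V V.v)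
        + interfaceIntegral M (fun F x =>
          jumpV (fun T y => V.ρ T y • V.v T y) F x * avg V.τ F x
            + inner ℝ (jump V.τ F x) (avg (fun T y => V.ρ T y • V.v T y) F x))
      = interfaceIntegral M (fun F x => α₁ * ‖jump V.τ F x‖ ^ 2 + α₂ * jumpV V.v F x ^ 2
          + inner ℝ (jump V.φ F x) (avg (fun T y => V.μ T y • V.v T y) F x)) := by
  have hjumpρv := continuous_jumpV fun T => (hρ T).smul (hv T)
  have havgρv := continuous_avg fun T => (hρ T).smul (hv T)
  have hjumpτ := continuous_jump hτ
  have hF₁ : ∀ F, Continuous ((stabilizedFluxes M D α₁ α₂ α₃).F₁ V V.τ F) := fun F =>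
    ((hjumpρv F).mul (continuous_avg hτ F)).neg.add
      (continuous_const.mul ((hjumpτ F).inner (hjumpτ F)))
  have hF₂ : ∀ F, Continuous ((stabilizedFluxes M D α₁ α₂ α₃).F₂ V V.v F) := fun F =>
    ((((hjumpτ F).inner (havgρv F)).neg.add ((continuous_jump hφ F).inner
      (continuous_avg (fun T => (hμ T).smul (hv T)) F)))).add
      (continuous_const.mul ((continuous_jumpV hv F).mul (continuous_jumpV hv F)))
  rw [← interfaceIntegral_add hF₁ hF₂, ← interfaceIntegral_add]
  · congr 1 with F x
    simp only [stabilizedFluxes, real_inner_self_eq_norm_sq]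
    ring
  · exact fun F => (hF₁ F).add (hF₂ F)
  · exact fun F => ((hjumpρv F).mul (continuous_avg hτ F)).add ((hjumpτ F).inner (havgρv F))

namespace IsSemiDiscrete

theorem domainIntegral_mass_add_momentum {Fl : Fluxes M} (hU : IsSemiDiscrete D k αB Fl t₁ U)
    (ht : t ∈ Ioo 0 t₁) :
    domainIntegral (fun T x => (timeDeriv (fun s => (U s).ρ) t T x
          + divergence (fun y => (U t).ρ T y • (U t).v T y) x) * (U t).τ T x)
        + domainIntegral (fun T x => inner ℝ
          ((U t).ρ T x • timeDeriv (fun s => (U s).v) t T x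
            + divConvection ((U t).ρ T) ((U t).v T) x
            - divergence (fun y => (U t).ρ T y • (U t).v T y) x • (U t).v T x
            + (U t).ρ T x • ∇ ((U t).τ T) x - (U t).μ T x • ∇ ((U t).φ T) x
            - ((1 / 2 : ℝ) * (U t).ρ T x) • ∇ (fun y => ‖(U t).v T y‖ ^ 2) x) ((U t).v T x))
      = domainIntegral (fun T x => (U t).τ T x * timeDeriv (fun s => (U s).ρ) t T x
          + (U t).ρ T x * inner ℝ (timeDeriv (fun s => (U s).v) t T x) ((U t).v T x)
          - (U t).μ T x * inner ℝ ((U t).v T x) (∇ ((U t).φ T) x))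
        + domainIntegral (fun T x =>
          divergence (fun y => (U t).τ T y • ((U t).ρ T y • (U t).v T y)) x) := by
  have htI := Ioo_subset_Icc_self ht
  have hρ := fun T => hU.contDiff_ρ (n := 1) htI T
  have hv := fun T => hU.contDiff_v (n := 1) htI T
  have hτ := fun T => hU.contDiff_τ (n := 1) htI T
  have hμ := fun T => (hU.contDiff_μ (n := 0) htI T).continuous
  have hρ' := fun T => (contDiff_of_mem_Vh (hU.timeDeriv_ρ_mem ht) (n := 0) T).continuous
  have hv' := fun T => (contDiff_of_mem_VhVec (hU.timeDeriv_v_mem ht) (n := 0) T).continuous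
  have hρv := fun T => (hρ T).smul (hv T)
  have hdiv := fun T => continuous_divergence (hρv T)
  have hgradφ := fun T => continuous_gradient (hU.contDiff_φ htI T)
  have hgradτ := fun T => continuous_gradient (hτ T)
  rw [← domainIntegral_add, ← domainIntegral_add]
  · congr 1 with T x
    rw [inner_momentum_density ((hρ T).differentiable one_ne_zero x)
      ((hv T).differentiable one_ne_zero x),
      divergence_smul (w := fun y => (U t).ρ T y • (U t).v T y)
      ((hτ T).differentiable one_ne_zero x) ((hρv T).differentiable one_ne_zero x)]
    simp only [real_inner_smul_left, real_inner_smul_right]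
    rw [real_inner_comm (∇ ((U t).φ T) x)]
    ring
  · exact fun T => ((((hτ T).continuous.mul (hρ' T)).add ((hρ T).continuous.mul
      ((hv' T).inner (hv T).continuous))).sub
      ((hμ T).mul ((hv T).continuous.inner (hgradφ T)))).continuousOn
  · exact fun T => (continuous_divergence ((hτ T).smul (hρv T))).continuousOn
  · exact fun T => (((hρ' T).add (hdiv T)).mul (hτ T).continuous).continuousOn
  · exact fun T => (((((((hρ T).continuous.smul (hv' T)).add
      (continuous_divConvection (hρ T) (hv T))).sub ((hdiv T).smul (hv T).continuous)).add
      ((hρ T).continuous.smul (hgradτ T))).sub ((hμ T).smul (hgradφ T))).sub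
      ((continuous_const.mul (hρ T).continuous).smul
        (continuous_gradient ((hv T).norm_sq ℝ)))).inner (hv T).continuous |>.continuousOn

/-- The test functions are chosen such that the densities of the four balances sum to the energy
rate. -/
theorem domainIntegral_energyRate_eq_add {Fl : Fluxes M} (hU : IsSemiDiscrete D k αB Fl t₁ U)
    (ht : t ∈ Ioo 0 t₁) :
    domainIntegral (energyRate D U t)
      = domainIntegral (fun T x => (U t).τ T x * timeDeriv (fun s => (U s).ρ) t T x
          + (U t).ρ T x * inner ℝ (timeDeriv (fun s => (U s).v) t T x) ((U t).v T x)
          - (U t).μ T x * inner ℝ ((U t).v T x) (∇ ((U t).φ T) x))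
        + domainIntegral (fun T x => (U t).μ T x * timeDeriv (fun s => (U s).φ) t T x
          + (U t).μ T x * inner ℝ ((U t).v T x) (∇ ((U t).φ T) x))
        + domainIntegral (fun T x =>
          D.dφ ((U t).ρ T x) ((U t).φ T x) * timeDeriv (fun s => (U s).φ) t T x
          + D.γ * inner ℝ (timeDeriv (fun s => (U s).σ) t T x) ((U t).σ T x)
          - (U t).μ T x * timeDeriv (fun s => (U s).φ) t T x)
        + domainIntegral (fun T x =>
          D.dρ ((U t).ρ T x) ((U t).φ T x) * timeDeriv (fun s => (U s).ρ) t T x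
          + 1 / 2 * ‖(U t).v T x‖ ^ 2 * timeDeriv (fun s => (U s).ρ) t T x
          - (U t).τ T x * timeDeriv (fun s => (U s).ρ) t T x) := by
  have htI := Ioo_subset_Icc_self ht
  have hρ := fun T => (hU.contDiff_ρ (n := 0) htI T).continuous
  have hv := fun T => (hU.contDiff_v (n := 0) htI T).continuous
  have hμ := fun T => (hU.contDiff_μ (n := 0) htI T).continuous
  have hτ := fun T => (hU.contDiff_τ (n := 0) htI T).continuous
  have hσ := fun T => (hU.contDiff_σ (n := 0) htI T).continuous
  have hρ' := fun T => (contDiff_of_mem_Vh (hU.timeDeriv_ρ_mem ht) (n := 0) T).continuous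
  have hφ' := fun T => (contDiff_of_mem_Vh (hU.timeDeriv_φ_mem ht) (n := 0) T).continuous
  have hv' := fun T => (contDiff_of_mem_VhVec (hU.timeDeriv_v_mem ht) (n := 0) T).continuous
  have hσ' := fun T => (contDiff_of_mem_VhVec (hU.timeDeriv_σ_mem ht) (n := 0) T).continuous
  have hadvection := fun T => (hμ T).mul
    ((hv T).inner (continuous_gradient (hU.contDiff_φ htI T)))
  have hmass_momentum := fun T => (((hτ T).mul (hρ' T)).add
    ((hρ T).mul ((hv' T).inner (hv T)))).sub (hadvection T)
  have hphase := fun T => ((hμ T).mul (hφ' T)).add (hadvection T)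
  have hchemical := fun T => (((hU.continuousOn_dφ htI T).mul (hφ' T).continuousOn).add
    (continuousOn_const (c := D.γ).mul ((hσ' T).inner (hσ T)).continuousOn)).sub
    ((hμ T).mul (hφ' T)).continuousOn
  rw [← domainIntegral_add, ← domainIntegral_add, ← domainIntegral_add]
  · congr 1 with T x
    simp only [energyRate]
    ring
  · exact fun T => ((hmass_momentum T).add (hphase T)).continuousOn.add (hchemical T)
  · exact fun T => (((hU.continuousOn_dρ htI T).mul (hρ' T).continuousOn).add
      ((continuous_const.mul ((hv T).norm.pow 2)).mul (hρ' T)).continuousOn).sub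
      ((hτ T).mul (hρ' T)).continuousOn
  · exact fun T => ((hmass_momentum T).add (hphase T)).continuousOn
  · exact hchemical
  · exact fun T => (hmass_momentum T).continuousOn
  · exact fun T => (hphase T).continuousOn

variable (hU : IsSemiDiscrete D k αB (stabilizedFluxes M D α₁ α₂ α₃) t₁ U) (ht : t ∈ Ioo 0 t₁)
include hU ht

/-- Integrating by parts leaves the fixed test function `Z` as the only differentiated one, so
that this form of the equation for `σ` can be differentiated in time. -/
theorem weak_gradient_σ {Z : Broken M (Vec d)} (hZ : Z ∈ VhNormal M k) :
    domainIntegral (fun T x => inner ℝ ((U t).σ T x) (Z T x))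
        + domainIntegral (fun T x => (U t).φ T x * divergence (Z T) x)
      = interfaceIntegral M (fun F x => avg (U t).φ F x * jumpV Z F x) := by
  have htI := Ioo_subset_Icc_self ht
  have hφ := fun T => hU.contDiff_φ (n := 1) htI T
  have hσ := fun T => (hU.contDiff_σ (n := 0) htI T).continuous
  have hZ₁ := fun T => contDiff_of_mem_VhVec hZ.1 (n := 1) T
  have hZ₀ := fun T => (hZ₁ T).continuous
  have hscheme := hU.gradient_σ t ht Z hZ
  have hparts := domainIntegral_divergence_smul hφ hZ₁ hZ.2
  have hcells : domainIntegral (fun T x => inner ℝ ((U t).σ T x) (Z T x))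
        + domainIntegral (fun T x => (U t).φ T x * divergence (Z T) x)
      = domainIntegral (fun T x => inner ℝ ((U t).σ T x - ∇ ((U t).φ T) x) (Z T x))
        + domainIntegral (fun T x => divergence (fun y => (U t).φ T y • Z T y) x) := by
    rw [← domainIntegral_add, ← domainIntegral_add]
    · congr 1 with T x
      rw [inner_sub_left, divergence_smul ((hφ T).differentiable one_ne_zero x)
        ((hZ₁ T).differentiable one_ne_zero x)]
      ring
    · exact fun T => (((hσ T).sub (continuous_gradient (hφ T))).inner (hZ₀ T)).continuousOn
    · exact fun T => (continuous_divergence ((hφ T).smul (hZ₁ T))).continuousOn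
    · exact fun T => ((hσ T).inner (hZ₀ T)).continuousOn
    · exact fun T => ((hφ T).continuous.mul (continuous_divergence (hZ₁ T))).continuousOn
  have hfaces : interfaceIntegral M (fun F x =>
        jumpV Z F x * avg (U t).φ F x + inner ℝ (jump (U t).φ F x) (avg Z F x))
      = interfaceIntegral M (fun F x => avg (U t).φ F x * jumpV Z F x)
        + interfaceIntegral M (fun F x => inner ℝ (jump (U t).φ F x) (avg Z F x)) := by
    have hφ₀ := fun T => (hφ T).continuous
    rw [← interfaceIntegral_add]
    · simp only [mul_comm]
    · exact fun F => (continuous_avg hφ₀ F).mul (continuous_jumpV hZ₀ F)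
    · exact fun F => (continuous_jump hφ₀ F).inner (continuous_avg hZ₀ F)
  simp only [stabilizedFluxes] at hscheme
  linarith

theorem weak_gradient_timeDeriv_σ {Z : Broken M (Vec d)} (hZ : Z ∈ VhNormal M k) :
    domainIntegral (fun T x => inner ℝ (timeDeriv (fun s => (U s).σ) t T x) (Z T x))
        + domainIntegral (fun T x => timeDeriv (fun s => (U s).φ) t T x * divergence (Z T) x)
      = interfaceIntegral M
          (fun F x => avg (timeDeriv (fun s => (U s).φ) t) F x * jumpV Z F x) := by
  have hZ₁ := fun T => contDiff_of_mem_VhVec hZ.1 (n := 1) T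
  have hZ₀ := fun T => (hZ₁ T).continuous
  have hmem := hU.eventually_mem ht
  have hφ_mem := hmem.mono fun _ hs => hs.2.2.1
  have hφ := hU.differentiableAt_φ ht
  have hcells := (hasDerivAt_domainIntegral_inner (hmem.mono fun _ hs => hs.2.2.2.2.2.1)
    (hU.differentiableAt_σ ht) hZ₀).add (hasDerivAt_domainIntegral_mul hφ_mem hφ
      fun T => (continuous_divergence (hZ₁ T)).continuousOn)
  have hfaces := hasDerivAt_interfaceIntegral_avg_mul hφ_mem hφ (continuous_jumpV hZ₀)
  refine hcells.unique (hfaces.congr_of_eventuallyEq ?_)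
  filter_upwards [Ioo_mem_nhds ht.1 ht.2] with s hs using hU.weak_gradient_σ hs hZ

/-- The mass balance tested with `τ` plus the momentum balance tested with `v`. -/
theorem mass_momentum_balance :
    domainIntegral (fun T x => (U t).τ T x * timeDeriv (fun s => (U s).ρ) t T x
        + (U t).ρ T x * inner ℝ (timeDeriv (fun s => (U s).v) t T x) ((U t).v T x)
        - (U t).μ T x * inner ℝ ((U t).v T x) (∇ ((U t).φ T) x))
      = - D.Bh αB (U t).φ (U t).v (U t).v
        - interfaceIntegral M (fun F x => α₁ * ‖jump (U t).τ F x‖ ^ 2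
          + α₂ * jumpV (U t).v F x ^ 2
          + inner ℝ (jump (U t).φ F x) (avg (fun T y => (U t).μ T y • (U t).v T y) F x)) := by
  have htI := Ioo_subset_Icc_self ht
  obtain ⟨-, hv_mem, -, -, hτ_mem, -⟩ := hU.mem t htI
  have hmass := hU.mass t ht _ hτ_mem
  have hmomentum := hU.momentum t ht _ hv_mem
  have hparts := domainIntegral_divergence_smul (w := fun T y => (U t).ρ T y • (U t).v T y)
    (hU.contDiff_τ htI) (fun T => (hU.contDiff_ρ htI T).smul (hU.contDiff_v htI T))
    fun F hF T hT x hx => by simp only [hv_mem.2 F hF T hT x hx, smul_zero, inner_zero_left]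
  have hcells := hU.domainIntegral_mass_add_momentum ht
  have hfaces := interfaceIntegral_mass_add_momentum D α₁ α₂ α₃
    (fun T => (hU.contDiff_ρ (n := 0) htI T).continuous)
    (fun T => (hU.contDiff_v (n := 0) htI T).continuous)
    (fun T => (hU.contDiff_φ (n := 0) htI T).continuous)
    (fun T => (hU.contDiff_μ (n := 0) htI T).continuous)
    (fun T => (hU.contDiff_τ (n := 0) htI T).continuous)
  simp only [timeDeriv] at hcells ⊢
  linarith

/-- The phase field equation tested with `μ`. -/
theorem phase_balance :
    domainIntegral (fun T x => (U t).μ T x * timeDeriv (fun s => (U s).φ) t T x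
        + (U t).μ T x * inner ℝ ((U t).v T x) (∇ ((U t).φ T) x))
      = - domainIntegral (fun T x => D.η / (U t).ρ T x * (U t).μ T x ^ 2)
        - interfaceIntegral M (fun F x => α₃ * ‖jump (U t).μ F x‖ ^ 2
          - inner ℝ (jump (U t).φ F x) (avg (fun T y => (U t).μ T y • (U t).v T y) F x)) := by
  have htI := Ioo_subset_Icc_self ht
  have hscheme := hU.phase t ht _ (hU.mem t htI).2.2.2.1
  have hρ := fun T => (hU.contDiff_ρ (n := 0) htI T).continuous
  have hv := fun T => (hU.contDiff_v (n := 0) htI T).continuous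
  have hμ := fun T => (hU.contDiff_μ (n := 0) htI T).continuous
  have hφ' := fun T => (contDiff_of_mem_Vh (hU.timeDeriv_φ_mem ht) (n := 0) T).continuous
  have hcells : domainIntegral (fun T x => (U t).μ T x * timeDeriv (fun s => (U s).φ) t T x
          + (U t).μ T x * inner ℝ ((U t).v T x) (∇ ((U t).φ T) x))
        + domainIntegral (fun T x => D.η / (U t).ρ T x * (U t).μ T x ^ 2)
      = domainIntegral (fun T x => (timeDeriv (fun s => (U s).φ) t T x
          + inner ℝ ((U t).v T x) (∇ ((U t).φ T) x)
          + D.η * ((U t).μ T x / (U t).ρ T x)) * (U t).μ T x) := by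
    rw [← domainIntegral_add]
    · congr 1 with T x
      ring
    · exact fun T => (((hμ T).mul (hφ' T)).add
        ((hμ T).mul ((hv T).inner (continuous_gradient (hU.contDiff_φ htI T))))).continuousOn
    · exact fun T => (continuousOn_const.div (hρ T).continuousOn fun x hx =>
        (hU.ρ_pos t htI T x hx).ne').mul ((hμ T).pow 2).continuousOn
  have hflux : (stabilizedFluxes M D α₁ α₂ α₃).F₃ (U t) (U t).μ = fun F x =>
      α₃ * ‖jump (U t).μ F x‖ ^ 2
        - inner ℝ (jump (U t).φ F x) (avg (fun T y => (U t).μ T y • (U t).v T y) F x) := by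
    funext F x
    simp only [stabilizedFluxes, real_inner_self_eq_norm_sq]
    ring
  simp only [timeDeriv] at hcells ⊢
  rw [hflux] at hscheme
  linarith

/-- The equation for `μ` tested with `∂ₜφ`, combined with the differentiated equation for `σ`
tested with `γ σ`. -/
theorem chemical_potential_balance :
    domainIntegral (fun T x =>
      D.dφ ((U t).ρ T x) ((U t).φ T x) * timeDeriv (fun s => (U s).φ) t T x
        + D.γ * inner ℝ (timeDeriv (fun s => (U s).σ) t T x) ((U t).σ T x)
        - (U t).μ T x * timeDeriv (fun s => (U s).φ) t T x) = 0 := by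
  have htI := Ioo_subset_Icc_self ht
  have hφ' := fun T => (contDiff_of_mem_Vh (hU.timeDeriv_φ_mem ht) (n := 0) T).continuous
  have hσ' := fun T => (contDiff_of_mem_VhVec (hU.timeDeriv_σ_mem ht) (n := 0) T).continuous
  have hσ := fun T => (hU.contDiff_σ (n := 0) htI T).continuous
  have hdivσ := fun T => continuous_divergence (hU.contDiff_σ htI T)
  have hμ := fun T => (hU.contDiff_μ (n := 0) htI T).continuous
  have hdφ := hU.continuousOn_dφ htI
  have hscheme := hU.potential_μ t ht _ (hU.timeDeriv_φ_mem ht)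
  have hσ_weak := hU.weak_gradient_timeDeriv_σ ht (hU.mem t htI).2.2.2.2.2
  have hcells : domainIntegral (fun T x =>
          D.dφ ((U t).ρ T x) ((U t).φ T x) * timeDeriv (fun s => (U s).φ) t T x
          + D.γ * inner ℝ (timeDeriv (fun s => (U s).σ) t T x) ((U t).σ T x)
          - (U t).μ T x * timeDeriv (fun s => (U s).φ) t T x)
        + domainIntegral (fun T x => ((U t).μ T x - D.dφ ((U t).ρ T x) ((U t).φ T x)
          + D.γ * divergence ((U t).σ T) x) * timeDeriv (fun s => (U s).φ) t T x)
      = D.γ * (domainIntegral (fun T x =>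
            inner ℝ (timeDeriv (fun s => (U s).σ) t T x) ((U t).σ T x))
          + domainIntegral (fun T x =>
            timeDeriv (fun s => (U s).φ) t T x * divergence ((U t).σ T) x)) := by
    rw [← domainIntegral_add, ← domainIntegral_add, ← domainIntegral_const_mul]
    · congr 1 with T x
      ring
    · exact fun T => ((hσ' T).inner (hσ T)).continuousOn
    · exact fun T => ((hφ' T).mul (hdivσ T)).continuousOn
    · exact fun T => (((hdφ T).mul (hφ' T).continuousOn).add
        (continuous_const.mul ((hσ' T).inner (hσ T))).continuousOn).sub
        ((hμ T).mul (hφ' T)).continuousOn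
    · exact fun T => (((hμ T).continuousOn.sub (hdφ T)).add
        (continuous_const.mul (hdivσ T)).continuousOn).mul (hφ' T).continuousOn
  have hflux : (stabilizedFluxes M D α₁ α₂ α₃).F₄ (U t) (timeDeriv (fun s => (U s).φ) t) =
      fun F x => -D.γ * (avg (timeDeriv (fun s => (U s).φ) t) F x * jumpV (U t).σ F x) := by
    funext F x
    simp only [stabilizedFluxes]
    ring
  rw [hσ_weak] at hcells
  rw [hflux, interfaceIntegral_const_mul] at hscheme
  linarith

/-- The equation for `τ` tested with `∂ₜρ`. -/
theorem pressure_potential_balance :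
    domainIntegral (fun T x =>
      D.dρ ((U t).ρ T x) ((U t).φ T x) * timeDeriv (fun s => (U s).ρ) t T x
        + 1 / 2 * ‖(U t).v T x‖ ^ 2 * timeDeriv (fun s => (U s).ρ) t T x
        - (U t).τ T x * timeDeriv (fun s => (U s).ρ) t T x) = 0 := by
  have hscheme := hU.potential_τ t ht _ (hU.timeDeriv_ρ_mem ht)
  have hflux : interfaceIntegral M ((stabilizedFluxes M D α₁ α₂ α₃).F₅ (U t)
      (timeDeriv (fun s => (U s).ρ) t)) = 0 := by
    simp [interfaceIntegral, faceIntegral, stabilizedFluxes]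
  rw [hflux, add_zero] at hscheme
  rw [← mul_zero (-1 : ℝ), hscheme, ← domainIntegral_const_mul]
  congr 1 with T x
  ring

theorem domainIntegral_energyRate :
    domainIntegral (energyRate D U t) =
      - domainIntegral (M := M) (fun T x => D.η / (U t).ρ T x * (U t).μ T x ^ 2)
        - D.Bh αB (U t).φ (U t).v (U t).v
        - interfaceIntegral M (fun F x =>
            α₁ * ‖jump (U t).τ F x‖ ^ 2 + α₂ * jumpV (U t).v F x ^ 2
              + α₃ * ‖jump (U t).μ F x‖ ^ 2) := by
  have htI := Ioo_subset_Icc_self ht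
  have hv := fun T => (hU.contDiff_v (n := 0) htI T).continuous
  have hμ := fun T => (hU.contDiff_μ (n := 0) htI T).continuous
  have hτ := fun T => (hU.contDiff_τ (n := 0) htI T).continuous
  have hφ := fun T => (hU.contDiff_φ (n := 0) htI T).continuous
  have hmass_momentum := hU.mass_momentum_balance ht
  have hphase := hU.phase_balance ht
  have hfaces : interfaceIntegral M (fun F x => α₁ * ‖jump (U t).τ F x‖ ^ 2
          + α₂ * jumpV (U t).v F x ^ 2
          + inner ℝ (jump (U t).φ F x) (avg (fun T y => (U t).μ T y • (U t).v T y) F x))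
        + interfaceIntegral M (fun F x => α₃ * ‖jump (U t).μ F x‖ ^ 2
          - inner ℝ (jump (U t).φ F x) (avg (fun T y => (U t).μ T y • (U t).v T y) F x))
      = interfaceIntegral M (fun F x =>
            α₁ * ‖jump (U t).τ F x‖ ^ 2 + α₂ * jumpV (U t).v F x ^ 2
              + α₃ * ‖jump (U t).μ F x‖ ^ 2) := by
    have hcoupling : ∀ F, Continuous fun x =>
        inner ℝ (jump (U t).φ F x) (avg (fun T y => (U t).μ T y • (U t).v T y) F x) := fun F =>
      (continuous_jump hφ F).inner (continuous_avg (fun T => (hμ T).smul (hv T)) F)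
    rw [← interfaceIntegral_add]
    · congr 1 with F x
      ring
    · exact fun F => ((continuous_const.mul ((continuous_jump hτ F).norm.pow 2)).add
        (continuous_const.mul ((continuous_jumpV hv F).pow 2))).add (hcoupling F)
    · exact fun F => (continuous_const.mul ((continuous_jump hμ F).norm.pow 2)).sub (hcoupling F)
  have hcells := hU.domainIntegral_energyRate_eq_add ht
  rw [hU.chemical_potential_balance ht, hU.pressure_potential_balance ht] at hcells
  linarith

end IsSemiDiscrete

end Dissipation

end

end NSAC

open NSAC in
theorem mainTheorem2_general {d : ℕ} {Ω : Set (Vec d)}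
    (M : Triangulation d Ω) (k : ℕ) (D : Model)
    (αB : ℝ) (hcoercive : D.IsCoercivePenalty M k αB)
    (α₁ α₂ α₃ : ℝ) (hα₁ : 0 ≤ α₁) (hα₂ : 0 ≤ α₂) (hα₃ : 0 ≤ α₃)
    (t₁ : ℝ) (U : ℝ → State M)
    (hU : IsSemiDiscrete D k αB (stabilizedFluxes M D α₁ α₂ α₃) t₁ U) :
    ∀ t ∈ Set.Ioo 0 t₁,
      HasDerivAt (fun s => D.energy (U s))
        (- domainIntegral (M := M) (fun T x => D.η / (U t).ρ T x * (U t).μ T x ^ 2)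
          - D.Bh αB (U t).φ (U t).v (U t).v
          - interfaceIntegral M (fun F x =>
              α₁ * ‖jump (U t).τ F x‖ ^ 2 + α₂ * jumpV (U t).v F x ^ 2
                + α₃ * ‖jump (U t).μ F x‖ ^ 2)) t ∧
      - domainIntegral (M := M) (fun T x => D.η / (U t).ρ T x * (U t).μ T x ^ 2)
          - D.Bh αB (U t).φ (U t).v (U t).v
          - interfaceIntegral M (fun F x =>
              α₁ * ‖jump (U t).τ F x‖ ^ 2 + α₂ * jumpV (U t).v F x ^ 2
                + α₃ * ‖jump (U t).μ F x‖ ^ 2) ≤ 0 := by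
  intro t ht
  have htI := Set.Ioo_subset_Icc_self ht
  have hmem := hU.mem t htI
  refine ⟨?_, ?_⟩
  · rw [← hU.domainIntegral_energyRate ht]
    exact hU.hasDerivAt_energy ht
  · have hreaction :
        0 ≤ domainIntegral (M := M) (fun T x => D.η / (U t).ρ T x * (U t).μ T x ^ 2) :=
      domainIntegral_nonneg fun T x hx =>
        mul_nonneg (div_nonneg D.η_pos.le (hU.ρ_pos t htI T x hx).le) (sq_nonneg _)
    have hviscous := hcoercive.Bh_nonneg hmem.2.2.1 (hU.φ_mem t htI) hmem.2.1
    have hstabilization : 0 ≤ interfaceIntegral M (fun F x =>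
        α₁ * ‖jump (U t).τ F x‖ ^ 2 + α₂ * jumpV (U t).v F x ^ 2
          + α₃ * ‖jump (U t).μ F x‖ ^ 2) :=
      interfaceIntegral_nonneg fun F x => by positivity
    linarith

open NSAC in
theorem mainTheorem2 {d : ℕ} (hd : 0 < d) {Ω : Set (Vec d)} (hΩ : interior (closure Ω) = Ω)
    (M : Triangulation d Ω) (k : ℕ) (D : Model)
    (αB : ℝ) (hαB : 0 < αB) (hcoercive : D.IsCoercivePenalty M k αB)
    (α₁ α₂ α₃ : ℝ) (hα₁ : 0 ≤ α₁) (hα₂ : 0 ≤ α₂) (hα₃ : 0 ≤ α₃)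
    (t₁ : ℝ) (U : ℝ → State M)
    (hU : IsSemiDiscrete D k αB (stabilizedFluxes M D α₁ α₂ α₃) t₁ U) :
    ∀ t ∈ Set.Ioo 0 t₁,
      HasDerivAt (fun s => D.energy (U s))
        (- domainIntegral (M := M) (fun T x => D.η / (U t).ρ T x * (U t).μ T x ^ 2)
          - D.Bh αB (U t).φ (U t).v (U t).v
          - interfaceIntegral M (fun F x =>
              α₁ * ‖jump (U t).τ F x‖ ^ 2 + α₂ * jumpV (U t).v F x ^ 2
                + α₃ * ‖jump (U t).μ F x‖ ^ 2)) t ∧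
      - domainIntegral (M := M) (fun T x => D.η / (U t).ρ T x * (U t).μ T x ^ 2)
          - D.Bh αB (U t).φ (U t).v (U t).v
          - interfaceIntegral M (fun F x =>
              α₁ * ‖jump (U t).τ F x‖ ^ 2 + α₂ * jumpV (U t).v F x ^ 2
                + α₃ * ‖jump (U t).μ F x‖ ^ 2) ≤ 0 :=
  mainTheorem2_general M k D αB hcoercive α₁ α₂ α₃ hα₁ hα₂ hα₃ t₁ U hU
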